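/- Norms of matrices are Euclidean: $|X|=(\sum_{i,j}X_{ij}^2)^{1/2}$. A set $\Omega\subset\mathbb{R}^m$ is a *regular domain* if it is open, bounded, connected, non-empty, and $\partial\Omega$ is a Lebesgue null set. A map $w\in W^{1,1}(\Omega,\mathbb{R}^d)$ is *piecewise affine* if, up to a null set, $\Omega$ is an at most countable union of pairwise disjoint regular domains $\Omega_i\subset\Omega$ such that $w$ agrees with an affine map on each $\Omega_i$. Let $U,K\subset\mathbb{R}^{d\times m}$ and $1<p<\infty$. We say that *$U$ can be $U$-reduced to $K$ exactly in weak $L^p$* if there are constants $M\ge 1$ and $m_0>0$ (depending only on $U,K,p$) such that for all $X_0\in U$, $b\in\mathbb{R}^d$, $\varepsilon,\alpha\in(0,1)$, $q\in(1,\infty)$ and every regular domain $\Omega\subset\mathbb{R}^m$ there is a piecewise affine map $w\in W^{1,1}(\Omega,\mathbb{R}^d)\cap C^{\alpha}(\overline\Omega,\mathbb{R}^d)$ with $w(x)=X_0x+b$ for $x\in\partial\Omega$ such that, with $\Omega_{err}=\{x\in\Omega:\nabla w(x)\notin K\}$, 1. $|\{x\in\Omega:|\nabla w(x)|>t\}|\le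 M^p(1+|X_0|^p)\,|\Omega|\,t^{-p}$ for all $t>0$; 2. $\nabla w(x)\in U$ for a.e. $x\in\Omega_{err}$; 3. $\int_{\Omega_{err}}(1+|\nabla w|)^q\,dx<\varepsilon|\Omega|$; 4. $|\{x\in\Omega:|\nabla w(x)|>t\}|\ge m_0^p\,|\Omega|\,t^{-p}$ for all $t>1$. For $\Lambda>1$ let $\mathcal{K}_\Lambda$ be the set of all $\begin{pmatrix}a&b\\c&d\end{pmatrix}\in\mathbb{R}^{2\times2}$ such that $\begin{pmatrix}\lambda&0\\0&\alpha\end{pmatrix}\begin{pmatrix}a\\b\end{pmatrix}+\begin{pmatrix}-d\\c\end{pmatrix}=0$ for some $\lambda\in\{\Lambda,\Lambda^{-1}\}$ and $\alpha\in[\Lambda^{-1},\Lambda]$. For $\Gamma>1$ let $\mathcal{K}_{\Lambda,\Gamma}$ be the set of all non-zero $\begin{pmatrix}a&b\\c&d\end{pmatrix}\in\mathcal{K}_\Lambda$ with $\Gamma^{-1}\le\frac{|a|+|b|}{|c|+|d|}\le\Gamma$. For $\bar a,\delta,\gamma>0$ let $$\mathcal{U}_{\bar a,\delta,\gamma}=\left\{\begin{pmatrix}a&b\\-c&d\end{pmatrix}\in\mathbb{R}^{2\times2}:\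 a,d>\bar a,\ \left|1-\tfrac ad\right|<\delta,\ |1-b|<\gamma,\ |1-c|<\gamma\right\}.$$ **Theorem.** For every $\Lambda>1$ there exist $\delta,\gamma,\bar a>0$ and $\Gamma>1$ such that $\mathcal{U}_{\bar a,\delta,\gamma}$ can be $\mathcal{U}_{\bar a,\delta,\gamma}$-reduced to $\mathcal{K}_{\Lambda,\Gamma}$ exactly in weak $L^p$ with $p=\frac{2\Lambda}{\Lambda-1}$. -/

import Mathlib

open MeasureTheory Set
open scoped NNReal ENNReal ContDiff Matrix

noncomputable section

namespace LaminateReduction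

/-- The Euclidean (Frobenius) norm `|X|` of a matrix `X ∈ ℝ^{d×m}`. -/
def matNorm {d m : ℕ} (X : Matrix (Fin d) (Fin m) ℝ) : ℝ :=
  Real.sqrt (∑ i, ∑ j, X i j ^ 2)

/-- The affine map `l_{X,b}(x) = X x + b` from `ℝ^m` to `ℝ^d`. -/
def affineMap {d m : ℕ} (X : Matrix (Fin d) (Fin m) ℝ) (b : EuclideanSpace ℝ (Fin d))
    (x : EuclideanSpace ℝ (Fin m)) : EuclideanSpace ℝ (Fin d) :=
  WithLp.toLp 2 (X *ᵥ x.ofLp) + b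

/-- A regular domain of `ℝ^m`: a (non-empty) open, bounded, connected set whose boundary is a
Lebesgue null set. -/
structure IsRegularDomain {m : ℕ} (Ω : Set (EuclideanSpace ℝ (Fin m))) : Prop where
  isOpen : IsOpen Ω
  isBounded : Bornology.IsBounded Ω
  isConnected : IsConnected Ω
  volume_frontier : volume (frontier Ω) = 0

/-- `w ∈ W^{1,1}(Ω, ℝ^d)` with weak gradient `∇w = G`, where `(∇w)_{ij} = ∂_j w_i`: all the
components of `w` and of `G` are integrable on `Ω`, and
`∫_Ω w_i ∂_j φ = - ∫_Ω G_{ij} φ` for every `φ ∈ C_c^∞(Ω)`. -/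
structure HasWeakGradientL1 {d m : ℕ} (Ω : Set (EuclideanSpace ℝ (Fin m)))
    (w : EuclideanSpace ℝ (Fin m) → EuclideanSpace ℝ (Fin d))
    (G : EuclideanSpace ℝ (Fin m) → Matrix (Fin d) (Fin m) ℝ) : Prop where
  integrableOn : ∀ i, IntegrableOn (fun x => w x i) Ω volume
  integrableOn_gradient : ∀ i j, IntegrableOn (fun x => G x i j) Ω volume
  integral_eq : ∀ φ : EuclideanSpace ℝ (Fin m) → ℝ,
    ContDiff ℝ ∞ φ → HasCompactSupport φ → tsupport φ ⊆ Ω → ∀ i j,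
      ∫ x in Ω, w x i * fderiv ℝ φ x (EuclideanSpace.single j 1) = - ∫ x in Ω, G x i j * φ x

/-- `Ω` is, up to a null set, an at most countable disjoint union of regular domains contained
in `Ω`, and `w` agrees with an affine map on each of them. -/
def IsPiecewiseAffineOn {d m : ℕ} (Ω : Set (EuclideanSpace ℝ (Fin m)))
    (w : EuclideanSpace ℝ (Fin m) → EuclideanSpace ℝ (Fin d)) : Prop :=
  ∃ S : Set (Set (EuclideanSpace ℝ (Fin m))),
    S.Countable ∧ S.PairwiseDisjoint id ∧
    (∀ V ∈ S, IsRegularDomain V ∧ V ⊆ Ω) ∧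
    volume (Ω \ ⋃₀ S) = 0 ∧
    ∀ V ∈ S, ∃ (X : Matrix (Fin d) (Fin m) ℝ) (b : EuclideanSpace ℝ (Fin d)),
      ∀ x ∈ V, w x = affineMap X b x

/-- `U` can be `U`-reduced to `K` exactly in weak `L^p` (for `1 < p < ∞`).

The constants `M` and `m₀` depend on `U`, `K`, `p` only. The gradient `∇w` is the weak gradient `G`
of `w`; all conditions on it are insensitive to changes on null sets. Measures and the integral of
the nonnegative function `(1 + |∇w|)^q` are taken in `[0, ∞]`. -/
def IsExactlyReducible {d m : ℕ} (U K : Set (Matrix (Fin d) (Fin m) ℝ)) (p : ℝ) : Prop :=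
  ∃ M : ℝ, 1 ≤ M ∧ ∃ m₀ : ℝ, 0 < m₀ ∧
    ∀ X₀ ∈ U, ∀ (b : EuclideanSpace ℝ (Fin d)) (ε : ℝ) (α : ℝ≥0) (q : ℝ)
      (Ω : Set (EuclideanSpace ℝ (Fin m))),
      0 < ε → ε < 1 → 0 < α → α < 1 → 1 < q → IsRegularDomain Ω →
      ∃ (w : EuclideanSpace ℝ (Fin m) → EuclideanSpace ℝ (Fin d))
        (G : EuclideanSpace ℝ (Fin m) → Matrix (Fin d) (Fin m) ℝ),
        -- `w` is a piecewise affine map in `W^{1,1}(Ω) ∩ C^α(closure Ω)` and `G = ∇w`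
        HasWeakGradientL1 Ω w G ∧ IsPiecewiseAffineOn Ω w ∧
        (∃ C : ℝ≥0, HolderOnWith C α w (closure Ω)) ∧
        -- the boundary values
        (∀ x ∈ frontier Ω, w x = affineMap X₀ b x) ∧
        -- the upper bound on the distribution function of the gradient
        (∀ t : ℝ, 0 < t →
          volume {x ∈ Ω | t < matNorm (G x)} ≤
            ENNReal.ofReal (M ^ p * (1 + matNorm X₀ ^ p) * t ^ (-p)) * volume Ω) ∧
        -- the gradient stays in `U` on the error set
        (∀ᵐ x ∂volume, x ∈ Ω → G x ∉ K → G x ∈ U) ∧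
        -- the error set is small
        (∫⁻ x in {x ∈ Ω | G x ∉ K}, ENNReal.ofReal ((1 + matNorm (G x)) ^ q) <
          ENNReal.ofReal ε * volume Ω) ∧
        -- the lower bound on the distribution function of the gradient
        (∀ t : ℝ, 1 < t →
          ENNReal.ofReal (m₀ ^ p * t ^ (-p)) * volume Ω ≤
            volume {x ∈ Ω | t < matNorm (G x)})

/-- The set `𝒦_Λ` of the matrices `!![a, b; c, d]` with `A (a, b)ᵀ + (-d, c)ᵀ = 0` for some
`A = diag(lam, α)`, `lam ∈ {Λ, Λ⁻¹}`, `α ∈ [Λ⁻¹, Λ]`. -/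
def setK (Λ : ℝ) : Set (Matrix (Fin 2) (Fin 2) ℝ) :=
  {X | ∃ lam ∈ ({Λ, Λ⁻¹} : Set ℝ), ∃ α ∈ Icc Λ⁻¹ Λ,
    !![lam, 0; 0, α] *ᵥ ![X 0 0, X 0 1] + ![-X 1 1, X 1 0] = 0}

/-- The set `𝒦_{Λ,Γ}` of the `X = !![a, b; c, d] ∈ 𝒦_Λ` with
`Γ⁻¹ ≤ (|a| + |b|) / (|c| + |d|) ≤ Γ`. (Within `𝒦_Λ` the denominator vanishes for `X = 0` only,
which does not belong to the set.) -/
def setKΓ (Λ Γ : ℝ) : Set (Matrix (Fin 2) (Fin 2) ℝ) :=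
  {X | X ∈ setK Λ ∧ (|X 0 0| + |X 0 1|) / (|X 1 0| + |X 1 1|) ∈ Icc Γ⁻¹ Γ}

/-- The set `𝒰_{ā,δ,γ}` of the matrices `!![a, b; -c, d]` with `a, d > ā`, `|1 - a/d| < δ`,
`|1 - b| < γ` and `|1 - c| < γ`. -/
def setU (abar δ γ : ℝ) : Set (Matrix (Fin 2) (Fin 2) ℝ) :=
  {X | ∃ a b c d : ℝ, X = !![a, b; -c, d] ∧ abar < a ∧ abar < d ∧
    |1 - a / d| < δ ∧ |1 - b| < γ ∧ |1 - c| < γ}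

end LaminateReduction

end

noncomputable section

namespace LaminateReduction

open Filter Topology Metric

/-! Put `κ = Λ / (Λ - 1)`, so that `Λ⁻¹ = 1 - 1/κ` and `p = 2κ`. A matrix with positive diagonal
`(x, y)` and off-diagonal entries `b, -c` with `b > 0` lies in `setK Λ` as soon as `y / x` is `Λ` or
`Λ⁻¹` and `c / b` lies in `[Λ⁻¹, Λ]`. From a large, nearly isotropic diagonal one climbs a
staircase: keep one diagonal entry `y`, and split the other one, `x`, into `y / Λ`, which lands in
the target set, and a larger value, which stays active; then swap the roles of the entries. The
barycentre condition determines the proportion that stays active. From the third step on it is `(n -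
κ) / (n + κ)`, with `n` growing by one per step, so after `k` steps a proportion of order `k^(-2κ)`
remains, while the gradients split off have size of order `k / 2`. This gives both weak `L^(2κ)`
bounds (`prod_le`, `le_prod`).

One splitting is realised by adding to one component of the map a scalar function made of pyramids
over disjoint kites that fill the active set up to a null set (`exists_two_gradient_function`,
`canSplit_of_forall`). Its derivative in one coordinate is `r` or `-s`; in the other it is `±σ`. The
proportion is exactly `s / (r + s)`, because the integral of a partial derivative of a compactly
supported Lipschitz function vanishes. The slopes `±σ` disturb only the off-diagonal entries, and
the total disturbance is kept below `γ`. The target set tolerates it, since `c / b` may range over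
an interval; hence the final gradients lie exactly in the target and the error set is null
(`stairFinal_subset`).

Infinitely many splittings converge (`exists_limit_map`): pyramids of small height give uniform
Hölder bounds, and summability of gradient size times remaining volume gives an integrable majorant
for the gradients. -/

/-- The plane with its Euclidean norm. -/
abbrev Plane := EuclideanSpace ℝ (Fin 2)

/-! ### Kites and the pyramids over them -/

/-- The asymmetric gauge whose sublevel sets are kites. -/
def kiteGauge (i j : Fin 2) (r s σ : ℝ) (y : Plane) : ℝ :=
  max (s * y i) (-(r * y i)) + σ * |y j|

section Gauge

variable {i j : Fin 2} {r s σ : ℝ}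

theorem abs_apply_le_norm (y : Plane) (k : Fin 2) : |y k| ≤ ‖y‖ :=
  PiLp.norm_apply_le y k

theorem norm_le_abs_add_abs (hij : i ≠ j) (y : Plane) : ‖y‖ ≤ |y i| + |y j| := by
  have h : ‖y‖ ≤ |y 0| + |y 1| := by
    rw [EuclideanSpace.norm_eq, Fin.sum_univ_two]
    apply Real.sqrt_le_iff.2 ⟨by positivity, ?_⟩
    simp only [Real.norm_eq_abs]
    nlinarith [abs_nonneg (y 0), abs_nonneg (y 1)]
  fin_cases i <;> fin_cases j <;> simp_all [add_comm]

theorem kiteGauge_sub_le (hr : 0 < r) (hs : 0 < s) (hσ : 0 < σ) (x y : Plane) :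
    kiteGauge i j r s σ x - kiteGauge i j r s σ y ≤ (r + s + σ) * ‖x - y‖ := by
  have hi := abs_apply_le_norm (x - y) i
  have hj := abs_apply_le_norm (x - y) j
  simp only [PiLp.sub_apply] at hi hj
  have h1 := le_abs_self (x i - y i)
  have h2 := neg_abs_le (x i - y i)
  have h3 := abs_sub_abs_le_abs_sub (x j) (y j)
  have hn := norm_nonneg (x - y)
  have h4 : max (s * x i) (-(r * x i)) ≤ max (s * y i) (-(r * y i)) + (r + s) * ‖x - y‖ := by
    apply max_le
    · have := le_max_left (s * y i) (-(r * y i))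
      nlinarith
    · have := le_max_right (s * y i) (-(r * y i))
      nlinarith
  unfold kiteGauge
  nlinarith

theorem le_kiteGauge (hij : i ≠ j) (hr : 0 < r) (hs : 0 < s) (hσ : 0 < σ) (y : Plane) :
    min r (min s σ) * ‖y‖ ≤ kiteGauge i j r s σ y := by
  have h := norm_le_abs_add_abs hij y
  set m := min r (min s σ)
  have hm : 0 < m := by positivity
  have m1 : m ≤ r := min_le_left _ _
  have m2 : m ≤ s := (min_le_right _ _).trans (min_le_left _ _)
  have m3 : m ≤ σ := (min_le_right _ _).trans (min_le_right _ _)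
  have h1 : m * |y i| ≤ max (s * y i) (-(r * y i)) := by
    rcases abs_cases (y i) with ⟨e, h0⟩ | ⟨e, h0⟩
    · exact le_max_of_le_left (by rw [e]; nlinarith)
    · exact le_max_of_le_right (by rw [e]; nlinarith)
  have h2 : m * |y j| ≤ σ * |y j| := by gcongr
  unfold kiteGauge
  nlinarith

theorem continuous_kiteGauge : Continuous (kiteGauge i j r s σ) := by
  unfold kiteGauge
  fun_prop

theorem kiteGauge_zero : kiteGauge i j r s σ 0 = 0 := by simp [kiteGauge]

theorem convexOn_kiteGauge (hσ : 0 < σ) : ConvexOn ℝ univ (kiteGauge i j r s σ) := by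
  refine ⟨convex_univ, fun x _ y _ a b ha hb _ => ?_⟩
  simp only [kiteGauge, PiLp.add_apply, PiLp.smul_apply, smul_eq_mul]
  have h1 : max (s * (a * x i + b * y i)) (-(r * (a * x i + b * y i))) ≤
      a * max (s * x i) (-(r * x i)) + b * max (s * y i) (-(r * y i)) := by
    apply max_le
    · nlinarith [le_max_left (s * x i) (-(r * x i)), le_max_left (s * y i) (-(r * y i))]
    · nlinarith [le_max_right (s * x i) (-(r * x i)), le_max_right (s * y i) (-(r * y i))]
  have h2 : |a * x j + b * y j| ≤ a * |x j| + b * |y j| := by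
    refine (abs_add_le _ _).trans_eq ?_
    rw [abs_mul, abs_mul, abs_of_nonneg ha, abs_of_nonneg hb]
  nlinarith

/-- A proper affine subspace is null. The origin and the two basis vectors show that the line is not
the whole plane. -/
theorem volume_line (hij : i ≠ j) {p q : ℝ} (hpq : p ≠ 0 ∨ q ≠ 0) (c : ℝ) :
    volume {y : Plane | p * y i + q * y j = c} = 0 := by
  let A : AffineSubspace ℝ Plane :=
    { carrier := {y : Plane | p * y i + q * y j = c}
      smul_vsub_vadd_mem' := by
        intro t x y z hx hy hz
        simp only [mem_ofPred_eq, vsub_eq_sub, vadd_eq_add, PiLp.add_apply, PiLp.smul_apply,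
          PiLp.sub_apply, smul_eq_mul] at *
        linear_combination t * hx - t * hy + hz }
  refine Measure.addHaar_affineSubspace volume A fun hA => ?_
  have hmem : ∀ y : Plane, p * y i + q * y j = c := fun y => by
    have : y ∈ A := by rw [hA]; trivial
    exact this
  have h0 := hmem 0
  have h1 := hmem (EuclideanSpace.single i 1)
  have h2 := hmem (EuclideanSpace.single j 1)
  simp [hij, hij.symm] at h0 h1 h2
  rcases hpq with h | h
  · exact h (h1.trans h0.symm)
  · exact h (h2.trans h0.symm)

end Gauge

/-- The closed kite with centre `a.1` and size `a.2`. -/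
def kite (i j : Fin 2) (r s σ : ℝ) (a : Plane × ℝ) : Set Plane :=
  {y | kiteGauge i j r s σ (y - a.1) ≤ a.2}

/-- One of the four open triangles into which the axes cut a kite. -/
def kitePiece (i j : Fin 2) (r s σ : ℝ) (a : Plane × ℝ) (ρ τ : ℝ) : Set Plane :=
  {y | 0 < ρ * (y i - a.1 i) ∧ 0 < τ * (y j - a.1 j) ∧ kiteGauge i j r s σ (y - a.1) < a.2}

open Classical in
/-- The function which is a pyramid over each of the kites `a ∈ u`, and zero elsewhere. -/
def roof (i j : Fin 2) (r s σ : ℝ) (u : Set (Plane × ℝ)) (y : Plane) : ℝ :=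
  if H : ∃ a ∈ u, y ∈ kite i j r s σ a then H.choose.2 - kiteGauge i j r s σ (y - H.choose.1) else 0

section Kite

variable {i j : Fin 2} {r s σ : ℝ} {a : Plane × ℝ} {ρ τ : ℝ} {u : Set (Plane × ℝ)}

theorem isClosed_kite : IsClosed (kite i j r s σ a) :=
  isClosed_le (continuous_kiteGauge.comp (continuous_id.sub continuous_const)) continuous_const

theorem kite_subset_closedBall (hij : i ≠ j) (hr : 0 < r) (hs : 0 < s) (hσ : 0 < σ) :
    kite i j r s σ a ⊆ closedBall a.1 (a.2 / min r (min s σ)) := fun y hy => by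
  have hm : 0 < min r (min s σ) := by positivity
  rw [mem_closedBall, dist_eq_norm, le_div_iff₀ hm, mul_comm]
  exact (le_kiteGauge hij hr hs hσ _).trans hy

theorem closedBall_subset_kite (hr : 0 < r) (hs : 0 < s) (hσ : 0 < σ) :
    closedBall a.1 (a.2 / (r + s + σ)) ⊆ kite i j r s σ a := fun y hy => by
  have h := kiteGauge_sub_le (i := i) (j := j) hr hs hσ (y - a.1) 0
  rw [mem_closedBall, dist_eq_norm, le_div_iff₀ (by positivity)] at hy
  rw [kiteGauge_zero, sub_zero, sub_zero] at h
  change kiteGauge i j r s σ (y - a.1) ≤ a.2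
  linarith

theorem kitePiece_subset_kite : kitePiece i j r s σ a ρ τ ⊆ kite i j r s σ a :=
  fun _ hy => hy.2.2.le

theorem isOpen_kitePiece : IsOpen (kitePiece i j r s σ a ρ τ) := by
  have h := continuous_kiteGauge (i := i) (j := j) (r := r) (s := s) (σ := σ)
  have h1 : IsOpen {y : Plane | 0 < ρ * (y i - a.1 i)} := isOpen_lt (by fun_prop) (by fun_prop)
  have h2 : IsOpen {y : Plane | 0 < τ * (y j - a.1 j)} := isOpen_lt (by fun_prop) (by fun_prop)
  have h3 : IsOpen {y : Plane | kiteGauge i j r s σ (y - a.1) < a.2} :=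
    isOpen_lt (by fun_prop) (by fun_prop)
  exact h1.inter (h2.inter h3)

theorem convex_kitePiece (hσ : 0 < σ) : Convex ℝ (kitePiece i j r s σ a ρ τ) := by
  intro x hx y hy p q hp hq hpq
  have e : ∀ k, (p • x + q • y) k - a.1 k = p * (x k - a.1 k) + q * (y k - a.1 k) := fun k => by
    simp only [PiLp.add_apply, PiLp.smul_apply, smul_eq_mul]
    linear_combination (a.1 k) * hpq
  have key : ∀ {A B : ℝ}, 0 < A → 0 < B → 0 < p * A + q * B := fun {A B} hA hB => by
    rcases hp.eq_or_lt with rfl | hp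
    · have : q = 1 := by linarith
      subst this; linarith
    · positivity
  refine ⟨?_, ?_, ?_⟩
  · rw [e, mul_add, mul_left_comm, mul_left_comm ρ q]
    exact key hx.1 hy.1
  · rw [e, mul_add, mul_left_comm, mul_left_comm τ q]
    exact key hx.2.1 hy.2.1
  · have h := (convexOn_kiteGauge (i := i) (j := j) (r := r) (s := s) hσ).2
      (mem_univ (x - a.1)) (mem_univ (y - a.1)) hp hq hpq
    have e' : p • x + q • y - a.1 = p • (x - a.1) + q • (y - a.1) := by
      rw [smul_sub, smul_sub, sub_add_sub_comm, ← add_smul, hpq, one_smul]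
    rw [e']
    simp only [smul_eq_mul] at h
    have := key (sub_pos.2 hx.2.2) (sub_pos.2 hy.2.2)
    have e2 : p * a.2 + q * a.2 = a.2 := by rw [← add_mul, hpq, one_mul]
    nlinarith

theorem nonempty_kitePiece (hij : i ≠ j) (hr : 0 < r) (hs : 0 < s) (hσ : 0 < σ) (ha : 0 < a.2)
    (hρ : ρ = 1 ∨ ρ = -1) (hτ : τ = 1 ∨ τ = -1) : (kitePiece i j r s σ a ρ τ).Nonempty := by
  set t := a.2 / (2 * (r + s + σ)) with ht
  have ht0 : 0 < t := by positivity
  have hta : (r + s + σ) * t < a.2 := by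
    rw [ht]; field_simp; linarith
  refine ⟨a.1 + EuclideanSpace.single i (ρ * t) + EuclideanSpace.single j (τ * t), ?_, ?_, ?_⟩
  · rcases hρ with rfl | rfl <;> simp [hij, ht0]
  · rcases hτ with rfl | rfl <;> simp [hij.symm, ht0]
  · have e : a.1 + EuclideanSpace.single i (ρ * t) + EuclideanSpace.single j (τ * t) - a.1 =
      EuclideanSpace.single i (ρ * t) + EuclideanSpace.single j (τ * t) := by abel
    rw [e]
    refine lt_of_le_of_lt ?_ hta
    have h1 : |τ * t| = t := by
      rcases hτ with rfl | rfl <;> simp [abs_of_pos ht0]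
    have h2 : max (s * (ρ * t)) (-(r * (ρ * t))) ≤ (r + s) * t := by
      rcases hρ with rfl | rfl <;> apply max_le <;> nlinarith
    simp only [kiteGauge, PiLp.add_apply, PiLp.single_apply, hij, hij.symm, if_true, if_false,
      add_zero, zero_add, h1]
    nlinarith

theorem isRegularDomain_kitePiece (hij : i ≠ j) (hr : 0 < r) (hs : 0 < s) (hσ : 0 < σ)
    (ha : 0 < a.2) (hρ : ρ = 1 ∨ ρ = -1) (hτ : τ = 1 ∨ τ = -1) :
    IsRegularDomain (kitePiece i j r s σ a ρ τ) where
  isOpen := isOpen_kitePiece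
  isBounded := isBounded_closedBall.subset
    (kitePiece_subset_kite.trans (kite_subset_closedBall hij hr hs hσ))
  isConnected := ⟨nonempty_kitePiece hij hr hs hσ ha hρ hτ,
    (convex_kitePiece hσ).isPreconnected⟩
  volume_frontier := (convex_kitePiece hσ).addHaar_frontier volume

theorem kiteGauge_of_mem_kitePiece (hr : 0 < r) (hs : 0 < s) (hρ : ρ = 1 ∨ ρ = -1)
    (hτ : τ = 1 ∨ τ = -1) {y : Plane} (hy : y ∈ kitePiece i j r s σ a ρ τ) :
    kiteGauge i j r s σ (y - a.1) =
      (if ρ = 1 then s else -r) * (y i - a.1 i) + σ * τ * (y j - a.1 j) := by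
  obtain ⟨h1, h2, -⟩ := hy
  simp only [kiteGauge, PiLp.sub_apply]
  congr 1
  · rcases hρ with rfl | rfl
    · rw [if_pos rfl]
      exact max_eq_left (by nlinarith)
    · rw [if_neg (by norm_num), max_eq_right (by nlinarith)]; ring
  · rcases hτ with rfl | rfl
    · rw [abs_of_pos (by linarith)]; ring
    · rw [abs_of_neg (by linarith)]; ring

/-- A kite is covered by its four triangles up to six lines. -/
theorem volume_kite_diff (hij : i ≠ j) (hr : 0 < r) (hs : 0 < s) (hσ : 0 < σ) :
    volume (kite i j r s σ a \ (kitePiece i j r s σ a (-1) 1 ∪ kitePiece i j r s σ a (-1) (-1) ∪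
      (kitePiece i j r s σ a 1 1 ∪ kitePiece i j r s σ a 1 (-1)))) = 0 := by
  have hsub : kite i j r s σ a \ (kitePiece i j r s σ a (-1) 1 ∪ kitePiece i j r s σ a (-1) (-1) ∪
      (kitePiece i j r s σ a 1 1 ∪ kitePiece i j r s σ a 1 (-1))) ⊆
      {y : Plane | (1 : ℝ) * y i + 0 * y j = a.1 i} ∪ {y : Plane | 0 * y i + (1 : ℝ) * y j = a.1 j}
      ∪ ({y : Plane | s * y i + σ * y j = a.2 + s * a.1 i + σ * a.1 j} ∪
        {y : Plane | s * y i + (-σ) * y j = a.2 + s * a.1 i - σ * a.1 j} ∪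
        ({y : Plane | (-r) * y i + σ * y j = a.2 - r * a.1 i + σ * a.1 j} ∪
        {y : Plane | (-r) * y i + (-σ) * y j = a.2 - r * a.1 i - σ * a.1 j})) := by
    rintro y ⟨hy, hn⟩
    simp only [kitePiece, mem_union, mem_ofPred_eq, not_or, not_and, not_lt] at hn ⊢
    obtain ⟨⟨n1, n2⟩, n3, n4⟩ := hn
    change kiteGauge i j r s σ (y - a.1) ≤ a.2 at hy
    rcases lt_trichotomy (y i) (a.1 i) with hi | hi | hi
    · rcases lt_trichotomy (y j) (a.1 j) with hj | hj | hj
      · have e := le_antisymm hy (n2 (by linarith) (by linarith))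
        simp only [kiteGauge, PiLp.sub_apply] at e
        rw [abs_of_neg (by linarith), max_eq_right (by nlinarith)] at e
        right; right; right; linarith
      · left; right; linarith
      · have e := le_antisymm hy (n1 (by linarith) (by linarith))
        simp only [kiteGauge, PiLp.sub_apply] at e
        rw [abs_of_pos (by linarith), max_eq_right (by nlinarith)] at e
        right; right; left; linarith
    · left; left; linarith
    · rcases lt_trichotomy (y j) (a.1 j) with hj | hj | hj
      · have e := le_antisymm hy (n4 (by linarith) (by linarith))
        simp only [kiteGauge, PiLp.sub_apply] at e
        rw [abs_of_neg (by linarith), max_eq_left (by nlinarith)] at e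
        right; left; right; linarith
      · left; right; linarith
      · have e := le_antisymm hy (n3 (by linarith) (by linarith))
        simp only [kiteGauge, PiLp.sub_apply] at e
        rw [abs_of_pos (by linarith), max_eq_left (by nlinarith)] at e
        right; left; left; linarith
  refine measure_mono_null hsub ?_
  simp only [measure_union_null_iff]
  refine ⟨⟨volume_line hij (by simp) _, volume_line hij (by simp) _⟩,
    ⟨volume_line hij (Or.inl hs.ne') _, volume_line hij (Or.inl hs.ne') _⟩,
    volume_line hij (Or.inr hσ.ne') _, volume_line hij (Or.inr (by simpa using hσ.ne')) _⟩

theorem roof_eq (hu : u.PairwiseDisjoint (kite i j r s σ)) (ha : a ∈ u) {y : Plane}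
    (hy : y ∈ kite i j r s σ a) : roof i j r s σ u y = a.2 - kiteGauge i j r s σ (y - a.1) := by
  have H : ∃ a ∈ u, y ∈ kite i j r s σ a := ⟨a, ha, hy⟩
  have e : H.choose = a := by
    by_contra hne
    exact (disjoint_left.1 (hu H.choose_spec.1 ha hne)) H.choose_spec.2 hy
  rw [roof, dif_pos H, e]

theorem roof_eq_zero {y : Plane} (hy : ∀ a ∈ u, y ∉ kite i j r s σ a) :
    roof i j r s σ u y = 0 := by
  rw [roof, dif_neg]
  rintro ⟨a, ha, h⟩
  exact hy a ha h

theorem roof_nonneg (y : Plane) : 0 ≤ roof i j r s σ u y := by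
  unfold roof
  split_ifs with H
  · exact sub_nonneg.2 H.choose_spec.2
  · exact le_rfl

/-- Outside its kite each cone is negative. So the roof is the upper envelope of the cones and zero,
and it inherits the Lipschitz constant of the gauge although it is defined by cases. -/
theorem le_roof (hu : u.PairwiseDisjoint (kite i j r s σ)) (ha : a ∈ u) (y : Plane) :
    a.2 - kiteGauge i j r s σ (y - a.1) ≤ roof i j r s σ u y := by
  by_cases hy : y ∈ kite i j r s σ a
  · rw [roof_eq hu ha hy]
  · have : a.2 < kiteGauge i j r s σ (y - a.1) := not_le.1 hy
    linarith [roof_nonneg (i := i) (j := j) (r := r) (s := s) (σ := σ) (u := u) y]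

theorem roof_sub_le (hu : u.PairwiseDisjoint (kite i j r s σ)) (hr : 0 < r) (hs : 0 < s)
    (hσ : 0 < σ) (x y : Plane) :
    roof i j r s σ u x - roof i j r s σ u y ≤ (r + s + σ) * ‖x - y‖ := by
  by_cases H : ∃ a ∈ u, x ∈ kite i j r s σ a
  · obtain ⟨a, ha, hx⟩ := H
    rw [roof_eq hu ha hx]
    have h1 := le_roof hu ha y
    have h2 := kiteGauge_sub_le (i := i) (j := j) hr hs hσ (y - a.1) (x - a.1)
    rw [sub_sub_sub_cancel_right, norm_sub_rev] at h2
    linarith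
  · push Not at H
    rw [roof_eq_zero H]
    have := roof_nonneg (i := i) (j := j) (r := r) (s := s) (σ := σ) (u := u) y
    have : 0 ≤ (r + s + σ) * ‖x - y‖ := by positivity
    linarith

theorem abs_roof_sub_le (hu : u.PairwiseDisjoint (kite i j r s σ)) (hr : 0 < r) (hs : 0 < s)
    (hσ : 0 < σ) (x y : Plane) :
    |roof i j r s σ u x - roof i j r s σ u y| ≤ (r + s + σ) * ‖x - y‖ := by
  rw [abs_sub_le_iff]
  refine ⟨roof_sub_le hu hr hs hσ x y, ?_⟩
  rw [norm_sub_rev]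
  exact roof_sub_le hu hr hs hσ y x

/-- Disjoint small kites filling an open set up to a null set. -/
theorem exists_kite_cover (hij : i ≠ j) (hr : 0 < r) (hs : 0 < s) (hσ : 0 < σ) {V : Set Plane}
    (hV : IsOpen V) {N : Plane → Set Plane} (hN : ∀ z ∈ V, N z ∈ 𝓝 z) {η : ℝ} (hη : 0 < η) :
    ∃ u : Set (Plane × ℝ), u.Countable ∧ u.PairwiseDisjoint (kite i j r s σ) ∧
      (∀ a ∈ u, a.1 ∈ V ∧ 0 < a.2 ∧ a.2 ≤ η ∧ kite i j r s σ a ⊆ V ∩ N a.1) ∧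
      volume (V \ ⋃ a ∈ u, kite i j r s σ a) = 0 := by
  set m := min r (min s σ) with hm
  have hm0 : 0 < m := by positivity
  set L := r + s + σ with hL
  have hL0 : 0 < L := by positivity
  let t : Set (Plane × ℝ) := {a | a.1 ∈ V ∧ 0 < a.2 ∧ a.2 ≤ η ∧ kite i j r s σ a ⊆ V ∩ N a.1}
  suffices H : ∃ u ⊆ t, u.Countable ∧ u.PairwiseDisjoint (kite i j r s σ) ∧
      volume (V \ ⋃ a ∈ u, kite i j r s σ a) = 0 by
    obtain ⟨u, hut, hu1, hu2, hu3⟩ := H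
    exact ⟨u, hu1, hu2, fun a ha => hut ha, hu3⟩
  -- Each kite lies between concentric balls whose radii have the fixed ratio `L / m`, so the volume
  -- of the tripled outer ball is controlled by that of the kite.
  refine Vitali.exists_disjoint_covering_ae (volume : Measure Plane) V t
    (Real.toNNReal ((3 * L / m) ^ Module.finrank ℝ Plane)) (fun a => a.2 / m) (fun a => a.1)
    (kite i j r s σ) (fun a _ => kite_subset_closedBall hij hr hs hσ) ?_ ?_
    (fun a _ => isClosed_kite) ?_
  · intro a ha
    have e : 3 * (a.2 / m) = (3 * L / m) * (a.2 / L) := by field_simp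
    rw [e, Measure.addHaar_closedBall_mul _ _ (by positivity) (div_nonneg ha.2.1.le hL0.le)]
    rw [← Measure.addHaar_closedBall_center volume a.1]
    change _ ≤ ENNReal.ofReal _ * _
    gcongr
    exact closedBall_subset_kite hr hs hσ
  · intro a ha
    refine ⟨a.1, mem_interior_iff_mem_nhds.2 (mem_of_superset (closedBall_mem_nhds _ ?_)
      (closedBall_subset_kite hr hs hσ))⟩
    exact div_pos ha.2.1 hL0
  · intro x hx ε hε
    obtain ⟨R, hR, hRs⟩ := Metric.mem_nhds_iff.1 (inter_mem (hV.mem_nhds hx) (hN x hx))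
    -- The size is at once a height bound `η`, fine enough for Vitali (`ε`), and small enough to fit
    -- strictly inside the ball of radius `R` (`R / 2`).
    refine ⟨(x, min η (m * min ε (R / 2))), ⟨hx, by positivity, min_le_left _ _, ?_⟩, ?_, rfl⟩
    · refine (kite_subset_closedBall hij hr hs hσ).trans ((closedBall_subset_ball ?_).trans hRs)
      rw [div_lt_iff₀ hm0]
      have h1 := min_le_right η (m * min ε (R / 2))
      have h2 := min_le_right ε (R / 2)
      change min η (m * min ε (R / 2)) < R * m
      nlinarith
    · rw [div_le_iff₀ hm0]
      have h1 := min_le_right η (m * min ε (R / 2))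
      have h2 := min_le_left ε (R / 2)
      change min η (m * min ε (R / 2)) ≤ ε * m
      nlinarith

end Kite

/-! ### Directional derivatives and the proportion of each slope -/

theorem lipschitzWith_of_abs_sub_le {f : Plane → ℝ} {L : ℝ}
    (hf : ∀ x y, |f x - f y| ≤ L * ‖x - y‖) : LipschitzWith L.toNNReal f :=
  LipschitzWith.of_dist_le' fun x y => by
    rw [Real.dist_eq, dist_eq_norm]; exact hf x y

/-- The integral of a partial derivative of a compactly supported Lipschitz function vanishes. -/
theorem integral_lineDeriv_eq_zero {f : Plane → ℝ} {C : ℝ≥0} (hf : LipschitzWith C f)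
    (hc : HasCompactSupport f) (v : Plane) : ∫ x, lineDeriv ℝ f x v = 0 := by
  have h := LipschitzWith.integral_lineDeriv_mul_eq (μ := (volume : Measure Plane))
    (LipschitzWith.const (1 : ℝ)) hf hc (-v)
  have h0 : ∀ x : Plane, lineDeriv ℝ (fun _ : Plane => (1 : ℝ)) x (-v) = 0 := fun x => by
    simp [lineDeriv]
  simp only [h0, neg_neg, zero_mul, integral_zero, mul_one] at h
  exact h.symm

/-- A zero of a nonnegative function is a minimum, and `deriv` vanishes there whether or not the
function is differentiable. This covers every point outside `V`, including its boundary, which need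
not be a null set. -/
theorem lineDeriv_eq_zero_of_isMin {f : Plane → ℝ} (h0 : ∀ x, 0 ≤ f x) {x : Plane} (hx : f x = 0)
    (v : Plane) : lineDeriv ℝ f x v = 0 := by
  apply IsLocalMin.deriv_eq_zero
  refine Filter.Eventually.of_forall fun t => ?_
  simp only [zero_smul, add_zero, hx]
  exact h0 _

theorem lineDeriv_of_eventually_affine {f : Plane → ℝ} {i j : Fin 2} (hij : i ≠ j) {x : Plane}
    {p q c : ℝ} (hf : ∀ᶠ y in 𝓝 x, f y = p * y i + q * y j + c) :
    lineDeriv ℝ f x (EuclideanSpace.single i 1) = p := by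
  rw [Filter.EventuallyEq.lineDeriv_eq hf]
  have e : (fun t : ℝ => p * (x + t • EuclideanSpace.single i (1 : ℝ) : Plane) i +
      q * (x + t • EuclideanSpace.single i (1 : ℝ) : Plane) j + c) =
      fun t => p * (x i + t) + q * x j + c := by
    funext t
    simp [hij.symm]
  rw [lineDeriv, e]
  have h : HasDerivAt (fun t : ℝ => p * (x i + t) + q * x j + c) (p * 1) 0 :=
    ((((hasDerivAt_id' (0 : ℝ)).const_add (x i)).const_mul p).add_const _).add_const _
  rw [h.deriv, mul_one]

/-- If the `i`-th partial derivative of a compactly supported function takes only two values on an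
open set, the measures of the two regions are inversely proportional to the values. -/
theorem volume_of_two_slopes {V V' W : Set Plane} (hVb : Bornology.IsBounded V)
    {i j : Fin 2} (hij : i ≠ j) {r s : ℝ} (hr : 0 < r) (hs : 0 < s) (hV'o : IsOpen V')
    (hV'V : V' ⊆ V) (hW : MeasurableSet W) (hWV : W ⊆ V) (hWV' : Disjoint V' W)
    (hnull : volume (V \ (V' ∪ W)) = 0) {f : Plane → ℝ} {C : ℝ≥0} (hlip : LipschitzWith C f)
    (h0 : ∀ x, 0 ≤ f x) (hzero : ∀ x ∉ V, f x = 0)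
    (hact : ∀ x ∈ V', ∃ τ c, ∀ᶠ y in 𝓝 x, f y = r * y i + τ * y j + c)
    (hfin : ∀ x ∈ W, ∃ τ c, ∀ᶠ y in 𝓝 x, f y = -s * y i + τ * y j + c) :
    volume.real V' = s / (r + s) * volume.real V := by
  have hfinV : volume V ≠ ⊤ := hVb.measure_lt_top.ne
  have hfinV' : volume V' ≠ ⊤ := measure_ne_top_of_subset hV'V hfinV
  have hfinW : volume (W) ≠ ⊤ := measure_ne_top_of_subset hWV hfinV
  have hsum : volume.real V' + volume.real (W) = volume.real V := by
    rw [← measureReal_union hWV' hW hfinV' hfinW]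
    have h1 : volume (V' ∪ W) = volume V := by
      refine le_antisymm (measure_mono (union_subset hV'V hWV)) ?_
      calc volume V ≤ volume ((V' ∪ W) ∪ (V \ (V' ∪ W))) :=
            measure_mono fun y hy => by
              by_cases h : y ∈ V' ∪ W
              exacts [Or.inl h, Or.inr ⟨hy, h⟩]
        _ ≤ volume (V' ∪ W) + 0 := by rw [← hnull]; exact measure_union_le _ _
        _ = _ := add_zero _
    rw [measureReal_def, h1, measureReal_def]
  have hcs : HasCompactSupport f := by
    refine HasCompactSupport.of_support_subset_isCompact hVb.isCompact_closure ?_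
    intro x hx
    by_contra h
    exact hx (hzero x fun hxV => h (subset_closure hxV))
  have hint := integral_lineDeriv_eq_zero hlip hcs
    (EuclideanSpace.single i 1)
  have hae : (fun x => lineDeriv ℝ f x (EuclideanSpace.single i 1)) =ᵐ[volume]
      fun x => V'.indicator (fun _ => r) x + (W).indicator (fun _ => -s) x := by
    have hn : ∀ᵐ x, x ∉ V \ (V' ∪ W) := measure_eq_zero_iff_ae_notMem.1 hnull
    filter_upwards [hn] with x hx
    by_cases hxV : x ∈ V
    · by_cases h1 : x ∈ V'
      · rw [indicator_of_mem h1, indicator_of_notMem (disjoint_left.1 hWV' h1), add_zero]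
        obtain ⟨τ, c, h⟩ := hact x h1
        exact lineDeriv_of_eventually_affine hij h
      · have h2 : x ∈ W := by
          by_contra h2
          exact hx ⟨hxV, by simp only [mem_union, not_or]; exact ⟨h1, h2⟩⟩
        rw [indicator_of_notMem h1, indicator_of_mem h2, zero_add]
        obtain ⟨τ, c, h⟩ := hfin x h2
        exact lineDeriv_of_eventually_affine hij h
    · rw [indicator_of_notMem fun h => hxV (hV'V h), indicator_of_notMem fun h => hxV (hWV h),
        add_zero]
      exact lineDeriv_eq_zero_of_isMin h0 (hzero x hxV) _
  -- The vanishing integral now reads `r |V'| = s |W|`; together with `|V'| + |W| = |V|` it fixes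
  -- the proportion.
  rw [integral_congr_ae hae, integral_add, integral_indicator_const _ hV'o.measurableSet,
    integral_indicator_const _ hW] at hint
  · simp only [smul_eq_mul] at hint
    field_simp
    rw [← hsum]
    linarith
  · exact (integrable_indicator_iff hV'o.measurableSet).2 (integrableOn_const hfinV')
  · exact (integrable_indicator_iff hW).2 (integrableOn_const hfinW)

/-- The basic construction: a small function on an open set `V` whose `i`-th partial derivative
takes only the values `r` and `-s`, and whose `j`-th partial derivative only takes the values
`±σ`. -/
theorem exists_two_gradient_function {V : Set Plane} (hV : IsOpen V) (hVb : Bornology.IsBounded V)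
    {N : Plane → Set Plane} (hN : ∀ z ∈ V, N z ∈ 𝓝 z) {i j : Fin 2} (hij : i ≠ j)
    {r s σ η : ℝ} (hr : 0 < r) (hs : 0 < s) (hσ : 0 < σ) (hη : 0 < η) :
    ∃ (f : Plane → ℝ) (V' : Set Plane) (Q : Set (Set Plane)),
      (∀ x y, |f x - f y| ≤ (r + s + σ) * ‖x - y‖) ∧ (∀ x, 0 ≤ f x ∧ f x ≤ η) ∧
      (∀ x ∉ V, f x = 0) ∧
      IsOpen V' ∧ V' ⊆ V ∧ volume.real V' = s / (r + s) * volume.real V ∧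
      Q.Countable ∧ Q.PairwiseDisjoint id ∧
      (∀ q ∈ Q, IsRegularDomain q ∧ q ⊆ V ∧ Disjoint q V') ∧
      volume (V \ (V' ∪ ⋃₀ Q)) = 0 ∧
      (∀ x ∈ V', ∃ z ∈ V, N z ∈ 𝓝 x ∧ ∃ τ, (τ = σ ∨ τ = -σ) ∧ ∃ c,
        ∀ᶠ y in 𝓝 x, f y = r * y i + τ * y j + c) ∧
      (∀ q ∈ Q, ∃ z ∈ V, q ⊆ N z ∧ ∃ τ, (τ = σ ∨ τ = -σ) ∧ ∃ c,
        ∀ y ∈ q, f y = -s * y i + τ * y j + c) := by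
  obtain ⟨u, huc, hud, hu, hcov⟩ := exists_kite_cover hij hr hs hσ hV hN hη
  set f := roof i j r s σ u with hf
  set P : Plane × ℝ → ℝ → ℝ → Set Plane := kitePiece i j r s σ with hP
  -- The half of each kite where the slope is `r` stays active; the two triangles with slope `-s`
  -- are final pieces.
  let V' : Set Plane := ⋃ a ∈ u, (P a (-1) 1 ∪ P a (-1) (-1))
  let Q : Set (Set Plane) := (fun a => P a 1 1) '' u ∪ (fun a => P a 1 (-1)) '' u
  have hPk : ∀ a ρ τ, P a ρ τ ⊆ kite i j r s σ a := fun a ρ τ => kitePiece_subset_kite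
  have hform : ∀ a ∈ u, ∀ ρ τ, (ρ = 1 ∨ ρ = -1) → (τ = 1 ∨ τ = -1) → ∀ y ∈ P a ρ τ,
      f y = (if ρ = 1 then -s else r) * y i + (-(σ * τ)) * y j +
        (a.2 + (if ρ = 1 then s else -r) * a.1 i + σ * τ * a.1 j) := by
    intro a ha ρ τ hρ hτ y hy
    rw [hf, roof_eq hud ha (hPk _ _ _ hy), kiteGauge_of_mem_kitePiece hr hs hρ hτ hy]
    split_ifs <;> ring
  have hdisj : ∀ a ∈ u, ∀ b ∈ u, ∀ ρ τ ρ' τ' y, y ∈ P a ρ τ → y ∈ P b ρ' τ' → a = b := by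
    intro a ha b hb ρ τ ρ' τ' y hya hyb
    by_contra hne
    exact disjoint_left.1 (hud ha hb hne) (hPk _ _ _ hya) (hPk _ _ _ hyb)
  have hQ : ∀ q, q ∈ Q ↔ ∃ a ∈ u, ∃ τ : ℝ, (τ = 1 ∨ τ = -1) ∧ q = P a 1 τ := by
    intro q
    constructor
    · rintro (⟨a, ha, rfl⟩ | ⟨a, ha, rfl⟩)
      exacts [⟨a, ha, 1, Or.inl rfl, rfl⟩, ⟨a, ha, -1, Or.inr rfl, rfl⟩]
    · rintro ⟨a, ha, τ, rfl | rfl, rfl⟩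
      exacts [Or.inl ⟨a, ha, rfl⟩, Or.inr ⟨a, ha, rfl⟩]
  have hV' : ∀ y, y ∈ V' ↔ ∃ a ∈ u, ∃ τ : ℝ, (τ = 1 ∨ τ = -1) ∧ y ∈ P a (-1) τ := by
    intro y
    simp only [V', mem_iUnion, mem_union, exists_prop]
    constructor
    · rintro ⟨a, ha, h | h⟩
      exacts [⟨a, ha, 1, Or.inl rfl, h⟩, ⟨a, ha, -1, Or.inr rfl, h⟩]
    · rintro ⟨a, ha, τ, rfl | rfl, h⟩
      exacts [⟨a, ha, Or.inl h⟩, ⟨a, ha, Or.inr h⟩]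
  have hPV : ∀ a ∈ u, ∀ ρ τ, P a ρ τ ⊆ V ∩ N a.1 := fun a ha ρ τ =>
    (hPk a ρ τ).trans (hu a ha).2.2.2
  have hzero : ∀ x ∉ V, f x = 0 := fun x hx =>
    roof_eq_zero fun a ha h => hx ((hu a ha).2.2.2 h).1
  have hlip := abs_roof_sub_le (i := i) (j := j) hud hr hs hσ
  have hV'o : IsOpen V' := isOpen_biUnion fun a _ => isOpen_kitePiece.union isOpen_kitePiece
  have hV'V : V' ⊆ V := fun y hy => by
    obtain ⟨a, ha, τ, -, h⟩ := (hV' y).1 hy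
    exact (hPV a ha _ _ h).1
  have hQc : Q.Countable := (huc.image _).union (huc.image _)
  have hQprop : ∀ q ∈ Q, IsRegularDomain q ∧ q ⊆ V ∧ Disjoint q V' := by
    intro q hq
    obtain ⟨a, ha, τ, hτ, rfl⟩ := (hQ q).1 hq
    refine ⟨isRegularDomain_kitePiece hij hr hs hσ (hu a ha).2.1 (Or.inl rfl) hτ,
      fun y hy => (hPV a ha _ _ hy).1, disjoint_left.2 fun y hy hy' => ?_⟩
    obtain ⟨b, hb, τ', -, h⟩ := (hV' y).1 hy'
    obtain rfl := hdisj a ha b hb _ _ _ _ y hy h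
    have h1 := hy.1
    have h2 := h.1
    linarith
  have hQdisj : Q.PairwiseDisjoint id := by
    intro q hq q' hq' hne
    obtain ⟨a, ha, τ, hτ, rfl⟩ := (hQ q).1 hq
    obtain ⟨b, hb, τ', hτ', rfl⟩ := (hQ q').1 hq'
    refine disjoint_left.2 fun y hy hy' => hne ?_
    obtain rfl := hdisj a ha b hb _ _ _ _ y hy hy'
    have h1 := hy.2.1
    have h2 := hy'.2.1
    rcases hτ with rfl | rfl <;> rcases hτ' with rfl | rfl <;> first | rfl | (exfalso; linarith)
  have hnull : volume (V \ (V' ∪ ⋃₀ Q)) = 0 := by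
    have hsub : V \ (V' ∪ ⋃₀ Q) ⊆ (V \ ⋃ a ∈ u, kite i j r s σ a) ∪
        ⋃ a ∈ u, (kite i j r s σ a \ (P a (-1) 1 ∪ P a (-1) (-1) ∪ (P a 1 1 ∪ P a 1 (-1)))) := by
      rintro y ⟨hyV, hyn⟩
      by_cases hy : y ∈ ⋃ a ∈ u, kite i j r s σ a
      · right
        simp only [mem_iUnion, exists_prop] at hy ⊢
        obtain ⟨a, ha, hya⟩ := hy
        refine ⟨a, ha, hya, fun h => hyn ?_⟩
        rcases h with (h | h) | (h | h)
        · exact Or.inl ((hV' y).2 ⟨a, ha, 1, Or.inl rfl, h⟩)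
        · exact Or.inl ((hV' y).2 ⟨a, ha, -1, Or.inr rfl, h⟩)
        · exact Or.inr ⟨_, (hQ _).2 ⟨a, ha, 1, Or.inl rfl, rfl⟩, h⟩
        · exact Or.inr ⟨_, (hQ _).2 ⟨a, ha, -1, Or.inr rfl, rfl⟩, h⟩
      · exact Or.inl ⟨hyV, hy⟩
    refine measure_mono_null hsub (measure_union_null hcov ?_)
    exact (measure_biUnion_null_iff huc).2 fun a _ => volume_kite_diff hij hr hs hσ
  have hact : ∀ x ∈ V', ∃ z ∈ V, N z ∈ 𝓝 x ∧ ∃ τ, (τ = σ ∨ τ = -σ) ∧ ∃ c,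
        ∀ᶠ y in 𝓝 x, f y = r * y i + τ * y j + c := by
    intro x hx
    obtain ⟨a, ha, τ, hτ, hxa⟩ := (hV' x).1 hx
    have hnh : P a (-1) τ ∈ 𝓝 x := isOpen_kitePiece.mem_nhds hxa
    refine ⟨a.1, (hu a ha).1, mem_of_superset hnh fun y hy => (hPV a ha _ _ hy).2, -(σ * τ), ?_,
      a.2 + -r * a.1 i + σ * τ * a.1 j, mem_of_superset hnh fun y hy => ?_⟩
    · rcases hτ with rfl | rfl <;> simp
    · exact (hform a ha (-1) τ (Or.inr rfl) hτ y hy).trans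
        (by rw [if_neg (by norm_num : ¬ (-1 : ℝ) = 1), if_neg (by norm_num : ¬ (-1 : ℝ) = 1)])
  have hfin : ∀ q ∈ Q, ∃ z ∈ V, q ⊆ N z ∧ ∃ τ, (τ = σ ∨ τ = -σ) ∧ ∃ c,
        ∀ y ∈ q, f y = -s * y i + τ * y j + c := by
    intro q hq
    obtain ⟨a, ha, τ, hτ, rfl⟩ := (hQ q).1 hq
    refine ⟨a.1, (hu a ha).1, fun y hy => (hPV a ha _ _ hy).2, -(σ * τ), ?_,
      a.2 + s * a.1 i + σ * τ * a.1 j, fun y hy => ?_⟩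
    · rcases hτ with rfl | rfl <;> simp
    · exact (hform a ha 1 τ (Or.inl rfl) hτ y hy).trans (by rw [if_pos rfl, if_pos rfl])
  have hvol : volume.real V' = s / (r + s) * volume.real V := by
    have hW : MeasurableSet (⋃₀ Q) :=
      MeasurableSet.sUnion hQc fun q hq => (hQprop q hq).1.isOpen.measurableSet
    have hWV : ⋃₀ Q ⊆ V := sUnion_subset fun q hq => (hQprop q hq).2.1
    have hWV' : Disjoint V' (⋃₀ Q) :=
      disjoint_sUnion_right.2 fun q hq => (hQprop q hq).2.2.symm
    exact volume_of_two_slopes hVb hij hr hs hV'o hV'V hW hWV hWV' hnull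
      (lipschitzWith_of_abs_sub_le hlip) (fun x => roof_nonneg x) hzero
      (fun x hx => by obtain ⟨z, -, -, τ, -, c, h⟩ := hact x hx; exact ⟨τ, c, h⟩)
      (fun x ⟨q, hq, hxq⟩ => by
        obtain ⟨z, -, -, τ, -, c, h⟩ := hfin q hq
        exact ⟨τ, c, mem_of_superset ((hQprop q hq).1.isOpen.mem_nhds hxq) h⟩)
  refine ⟨f, V', Q, hlip, fun x => ⟨roof_nonneg x, ?_⟩, hzero, hV'o, hV'V, hvol, hQc, hQdisj,
    hQprop, hnull, hact, hfin⟩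
  by_cases H : ∃ a ∈ u, x ∈ kite i j r s σ a
  · obtain ⟨a, ha, hx⟩ := H
    rw [hf, roof_eq hud ha hx]
    have hm : 0 < min r (min s σ) := by positivity
    have h1 := le_kiteGauge hij hr hs hσ (x - a.1)
    have h2 := (hu a ha).2.2.1
    have h3 : 0 ≤ min r (min s σ) * ‖x - a.1‖ := by positivity
    linarith
  · push Not at H
    rw [hf, roof_eq_zero H]
    exact hη.le

/-! ### Splitting the gradient of a locally affine map -/

/-- Real `2 × 2` matrices. -/
abbrev Mat := Matrix (Fin 2) (Fin 2) ℝ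

/-- `w` is locally affine on `V` with gradients in `S`. -/
def HasLocalGradientIn (S : Set Mat) (V : Set Plane) (w : Plane → Plane) : Prop :=
  ∀ x ∈ V, ∃ X ∈ S, ∃ b, ∀ᶠ y in 𝓝 x, w y = affineMap X b y

/-- `w'` is a modification of `w` on `V`, which is affine with gradient in `T` on each of the
regular domains `q ∈ Q`; these fill `V \ V'`, and `V'` is the proportion `π` of `V`. -/
structure SplitStep (T : Set Mat) (π L η : ℝ) (V : Set Plane) (w : Plane → Plane) (V' : Set Plane)
    (w' : Plane → Plane) (Q : Set (Set Plane)) : Prop where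
  lipschitz : ∀ x y, ‖(w' x - w x) - (w' y - w y)‖ ≤ L * ‖x - y‖
  norm_sub_le : ∀ x, ‖w' x - w x‖ ≤ η
  eq_off : ∀ x ∉ V, w' x = w x
  subset : V' ⊆ V
  volume_eq : volume.real V' = π * volume.real V
  countable : Q.Countable
  pairwiseDisjoint : Q.PairwiseDisjoint id
  isRegularDomain : ∀ q ∈ Q, IsRegularDomain q
  subset_of_mem : ∀ q ∈ Q, q ⊆ V
  disjoint : ∀ q ∈ Q, Disjoint q V'
  volume_diff : volume (V \ (V' ∪ ⋃₀ Q)) = 0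
  affine : ∀ q ∈ Q, ∃ Y ∈ T, ∃ b, ∀ y ∈ q, w' y = affineMap Y b y

/-- Maps with gradients in `S` can be modified to maps which have gradients in `S'` on the
proportion `π` of their domain, and gradients in `T` on the rest. -/
def CanSplit (S T S' : Set Mat) (π L : ℝ) : Prop :=
  ∀ (V : Set Plane) (w : Plane → Plane) (η : ℝ), IsOpen V → Bornology.IsBounded V →
    HasLocalGradientIn S V w → 0 < η →
    ∃ V' w' Q, IsOpen V' ∧ HasLocalGradientIn S' V' w' ∧ SplitStep T π L η V w V' w' Q

theorem affineMap_add_single (X : Mat) (b y : Plane) (i j : Fin 2) (p q c : ℝ) :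
    affineMap X b y + EuclideanSpace.single i (p * y i + q * y j + c) =
      affineMap (X + Matrix.single i i p + Matrix.single i j q)
        (b + EuclideanSpace.single i c) y := by
  ext k
  simp only [affineMap, Matrix.add_mulVec, PiLp.add_apply, Pi.add_apply, PiLp.single_apply,
    Matrix.single_mulVec]
  by_cases h : k = i
  · subst h; simp; ring
  · simp [h]

/-- Splitting along the rank-one direction which changes the `i`-th diagonal entry. -/
theorem canSplit_of_forall {S T S' : Set Mat} {i j : Fin 2} (hij : i ≠ j) {r s σ : ℝ} (hr : 0 < r)
    (hs : 0 < s) (hσ : 0 < σ)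
    (hS' : ∀ X ∈ S, ∀ τ, (τ = σ ∨ τ = -σ) → X + Matrix.single i i r + Matrix.single i j τ ∈ S')
    (hT : ∀ X ∈ S, ∀ τ, (τ = σ ∨ τ = -σ) → X + Matrix.single i i (-s) + Matrix.single i j τ ∈ T) :
    CanSplit S T S' (s / (r + s)) (r + s + σ) := by
  intro V w η hV hVb hw hη
  choose! X hX b hb using hw
  obtain ⟨f, V', Q, hlip, hbd, hzero, hV'o, hV'V, hvol, hQc, hQd, hQ, hnull, hact, hfin⟩ :=
    exists_two_gradient_function hV hVb
      -- Kites centred at `z` stay where `w` is a single affine map, so on each triangle the sum of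
      -- `w` and the pyramid is affine. The interior is taken so that the identity holds near every
      -- point of the kite.
      (N := fun z => interior {y | w y = affineMap (X z) (b z) y})
      (fun z hz => interior_mem_nhds.2 (hb z hz)) hij hr hs hσ hη
  have hdiff : ∀ x, w x + EuclideanSpace.single i (f x) - w x = EuclideanSpace.single i (f x) :=
    fun x => add_sub_cancel_left _ _
  refine ⟨V', fun x => w x + EuclideanSpace.single i (f x), Q, hV'o, ?_, ?_, ?_, ?_, hV'V, hvol,
    hQc, hQd, fun q hq => (hQ q hq).1, fun q hq => (hQ q hq).2.1, fun q hq => (hQ q hq).2.2,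
    hnull, ?_⟩
  · intro x hx
    obtain ⟨z, hz, hN, τ, hτ, c, h⟩ := hact x hx
    refine ⟨_, hS' (X z) (hX z hz) τ hτ, b z + EuclideanSpace.single i c, ?_⟩
    filter_upwards [hN, h] with y hy1 hy2
    have hy1' : y ∈ {y | w y = affineMap (X z) (b z) y} := interior_subset hy1
    rw [mem_ofPred_eq] at hy1'
    rw [hy1', hy2, affineMap_add_single]
  · intro x y
    have e : EuclideanSpace.single i (f x) - EuclideanSpace.single i (f y) =
        (EuclideanSpace.single i (f x - f y) : Plane) := by
      ext k; by_cases h : k = i <;> simp [h]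
    rw [hdiff, hdiff, e, PiLp.norm_single, Real.norm_eq_abs]
    exact hlip x y
  · intro x
    rw [hdiff, PiLp.norm_single, Real.norm_eq_abs, abs_of_nonneg (hbd x).1]
    exact (hbd x).2
  · intro x hx
    simp [hzero x hx]
  · intro q hq
    obtain ⟨z, hz, hN, τ, hτ, c, h⟩ := hfin q hq
    refine ⟨_, hT (X z) (hX z hz) τ hτ, b z + EuclideanSpace.single i c, fun y hy => ?_⟩
    have hy1' : y ∈ {y | w y = affineMap (X z) (b z) y} := interior_subset (hN hy)
    rw [mem_ofPred_eq] at hy1'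
    rw [hy1', h y hy, affineMap_add_single]

/-! ### Iterated splitting -/

theorem exists_split_sequence {S T : ℕ → Set Mat} {π L η : ℕ → ℝ}
    (hsplit : ∀ k, CanSplit (S k) (T k) (S (k + 1)) (π k) (L k)) (hη : ∀ k, 0 < η k)
    {Ω : Set Plane} (hΩ : IsOpen Ω) (hΩb : Bornology.IsBounded Ω) {w₀ : Plane → Plane}
    (hw₀ : HasLocalGradientIn (S 0) Ω w₀) :
    ∃ (V : ℕ → Set Plane) (w : ℕ → Plane → Plane) (Q : ℕ → Set (Set Plane)),
      V 0 = Ω ∧ w 0 = w₀ ∧ (∀ k, IsOpen (V k)) ∧ (∀ k, HasLocalGradientIn (S k) (V k) (w k)) ∧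
      ∀ k, SplitStep (T k) (π k) (L k) (η k) (V k) (w k) (V (k + 1)) (w (k + 1)) (Q k) := by
  -- The recursion carries the facts that the next splitting requires, with a gradient set depending
  -- on the step; the state is therefore a dependent type.
  let St : ℕ → Type := fun k => {p : Set Plane × (Plane → Plane) //
    IsOpen p.1 ∧ Bornology.IsBounded p.1 ∧ HasLocalGradientIn (S k) p.1 p.2}
  have hstep : ∀ k, ∀ p : St k, ∃ p' : St (k + 1), ∃ Q,
      SplitStep (T k) (π k) (L k) (η k) p.1.1 p.1.2 p'.1.1 p'.1.2 Q := by
    rintro k ⟨⟨V, w⟩, hV, hVb, hw⟩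
    obtain ⟨V', w', Q, hV', hw', h⟩ := hsplit k V w (η k) hV hVb hw (hη k)
    exact ⟨⟨⟨V', w'⟩, hV', hVb.subset h.subset, hw'⟩, Q, h⟩
  choose next Q hnext using hstep
  let sq : ∀ k, St k := fun k => Nat.rec (motive := St) ⟨(Ω, w₀), hΩ, hΩb, hw₀⟩ next k
  exact ⟨fun k => (sq k).1.1, fun k => (sq k).1.2, fun k => Q k (sq k), rfl, rfl,
    fun k => (sq k).2.1, fun k => (sq k).2.2.2, fun k => hnext k (sq k)⟩

theorem lineDeriv_of_eventually_eq_affineMap {w : Plane → Plane} {x : Plane} {X : Mat} {b : Plane}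
    (h : ∀ᶠ y in 𝓝 x, w y = affineMap X b y) (i j : Fin 2) :
    lineDeriv ℝ (fun y => w y i) x (EuclideanSpace.single j 1) = X i j := by
  have hw : (fun y => w y i) =ᶠ[𝓝 x] fun y => affineMap X b y i := by
    filter_upwards [h] with y hy
    rw [hy]
  rw [hw.lineDeriv_eq, lineDeriv]
  have e : (fun t : ℝ => affineMap X b (x + t • EuclideanSpace.single j (1 : ℝ)) i) =
      fun t => affineMap X b x i + t * X i j := by
    funext t
    fin_cases i <;> fin_cases j <;> simp [affineMap] <;> ring
  rw [e]
  have h : HasDerivAt (fun t : ℝ => affineMap X b x i + t * X i j) (1 * X i j) 0 :=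
    ((hasDerivAt_id' (0 : ℝ)).mul_const _).const_add _
  rw [h.deriv, one_mul]

theorem exists_norm_affineMap_sub_le (X : Mat) (b : Plane) :
    ∃ C, 0 ≤ C ∧ ∀ x y, ‖affineMap X b x - affineMap X b y‖ ≤ C * ‖x - y‖ := by
  refine ⟨‖Matrix.toEuclideanCLM (𝕜 := ℝ) X‖, norm_nonneg _, fun x y => ?_⟩
  have e : affineMap X b x - affineMap X b y = Matrix.toEuclideanCLM (𝕜 := ℝ) X (x - y) := by
    ext k
    simp [affineMap]
  rw [e]
  exact ContinuousLinearMap.le_opNorm _ _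

/-- Interpolation between a Lipschitz bound and a uniform bound: write `d = d^α d^(1-α)` and use one
bound on each factor. -/
theorem le_rpow_interpolate {d L B δ α : ℝ} (hd : 0 ≤ d) (hL : 0 ≤ L) (hδ : 0 ≤ δ) (hα : 0 < α)
    (hα1 : α < 1) (h1 : d ≤ L * δ) (h2 : d ≤ B) : d ≤ L ^ α * B ^ (1 - α) * δ ^ α := by
  calc d = d ^ α * d ^ (1 - α) := by
        rcases hd.eq_or_lt with rfl | hd
        · rw [Real.zero_rpow hα.ne', zero_mul]
        · rw [← Real.rpow_add hd]; simp
    _ ≤ (L * δ) ^ α * B ^ (1 - α) := by gcongr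
    _ = _ := by rw [Real.mul_rpow hL hδ]; ring

/-- Since `α < 1`, a small enough height compensates any Lipschitz constant in the Hölder seminorm
of a correction. -/
theorem exists_small_amplitude (L : ℝ) {α ε : ℝ} (hα1 : α < 1) (hε : 0 < ε) :
    ∃ η, 0 < η ∧ η ≤ ε ∧ L ^ α * (2 * η) ^ (1 - α) ≤ ε := by
  have h1 : Tendsto (fun η : ℝ => L ^ α * (2 * η) ^ (1 - α)) (𝓝[>] 0) (𝓝 0) := by
    have h2 : Tendsto (fun η : ℝ => (2 * η) ^ (1 - α)) (𝓝 0) (𝓝 0) := by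
      have h3 : ContinuousAt (fun η : ℝ => (2 * η) ^ (1 - α)) 0 :=
        ContinuousAt.rpow_const (by fun_prop) (Or.inr (by linarith))
      have h4 := h3.tendsto
      simp only [mul_zero] at h4
      rwa [Real.zero_rpow (by linarith)] at h4
    simpa using (h2.const_mul (L ^ α)).mono_left nhdsWithin_le_nhds
  obtain ⟨η, h, hη⟩ := ((h1.eventually_le_const hε).and (Ioc_mem_nhdsGT hε)).exists
  exact ⟨η, hη.1, hη.2, h⟩

theorem holderOnWith_of_norm_sub_le {w : Plane → Plane} {A : Set Plane} {C : ℝ} {α : ℝ≥0}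
    (h : ∀ x ∈ A, ∀ y ∈ A, ‖w x - w y‖ ≤ C * ‖x - y‖ ^ (α : ℝ)) :
    HolderOnWith C.toNNReal α w A := by
  intro x hx y hy
  rw [edist_nndist, edist_nndist, ← ENNReal.coe_rpow_of_nonneg _ α.coe_nonneg, ← ENNReal.coe_mul,
    ENNReal.coe_le_coe, ← NNReal.coe_le_coe]
  push_cast
  rw [dist_eq_norm, dist_eq_norm]
  refine (h x hx y hy).trans ?_
  gcongr
  exact Real.le_coe_toNNReal C

theorem setIntegral_mul_fderiv_eq_neg {g φ : Plane → ℝ} {C : ℝ≥0} (hg : LipschitzWith C g)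
    (hφ : ContDiff ℝ ∞ φ) (hc : HasCompactSupport φ) {Ω : Set Plane} (hΩ : tsupport φ ⊆ Ω)
    (v : Plane) :
    ∫ x in Ω, g x * fderiv ℝ φ x v = -∫ x in Ω, lineDeriv ℝ g x v * φ x := by
  have hφ1 : ContDiff ℝ 1 φ := hφ.of_le (by exact_mod_cast le_top)
  obtain ⟨D, hD⟩ := hφ1.lipschitzWith_of_hasCompactSupport hc one_ne_zero
  have h := LipschitzWith.integral_lineDeriv_mul_eq (μ := (volume : Measure Plane)) hg hD hc v
  have e : ∀ x, lineDeriv ℝ φ x (-v) = -fderiv ℝ φ x v := fun x => by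
    rw [((hφ1.differentiable one_ne_zero) x).lineDeriv_eq_fderiv, map_neg]
  rw [setIntegral_eq_integral_of_forall_compl_eq_zero,
    setIntegral_eq_integral_of_forall_compl_eq_zero, h, ← integral_neg]
  · simp only [e, neg_mul, neg_neg]
    simp only [mul_comm]
  · intro x hx
    rw [image_eq_zero_of_notMem_tsupport fun h => hx (hΩ h), mul_zero]
  · intro x hx
    have : fderiv ℝ φ x = 0 := by
      apply image_eq_zero_of_notMem_tsupport
      exact fun h => hx (hΩ (tsupport_fderiv_subset ℝ h))
    simp [this]

/-- A sequence of successive modifications of a map. -/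
structure SplitSequence (S T : ℕ → Set Mat) (π L η : ℕ → ℝ) (V : ℕ → Set Plane)
    (w : ℕ → Plane → Plane) (Q : ℕ → Set (Set Plane)) : Prop where
  isOpen : ∀ k, IsOpen (V k)
  gradient : ∀ k, HasLocalGradientIn (S k) (V k) (w k)
  step : ∀ k, SplitStep (T k) (π k) (L k) (η k) (V k) (w k) (V (k + 1)) (w (k + 1)) (Q k)

namespace SplitSequence

variable {S T : ℕ → Set Mat} {π L η : ℕ → ℝ} {V : ℕ → Set Plane} {w : ℕ → Plane → Plane}
  {Q : ℕ → Set (Set Plane)}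

theorem antitone (h : SplitSequence S T π L η V w Q) : Antitone V :=
  antitone_nat_of_succ_le fun k => (h.step k).subset

theorem volume_real (h : SplitSequence S T π L η V w Q) (k : ℕ) :
    volume.real (V k) = (∏ m ∈ Finset.range k, π m) * volume.real (V 0) := by
  induction k with
  | zero => simp
  | succ k ih => rw [(h.step k).volume_eq, ih, Finset.prod_range_succ]; ring

theorem eq_of_notMem (h : SplitSequence S T π L η V w Q) {k : ℕ} {x : Plane} (hx : x ∉ V k) {m : ℕ}
    (hm : k ≤ m) : w m x = w k x := by
  induction m, hm using Nat.le_induction with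
  | base => rfl
  | succ m hm ih => rw [(h.step m).eq_off x fun hx' => hx (h.antitone hm hx'), ih]

/-- A point that never leaves the active sets lies in their null intersection. Any other point has a
last active step, and off a null set it then lies in a final piece. -/
theorem ae_mem (h : SplitSequence S T π L η V w Q)
    (h0 : Tendsto (fun k => volume (V k)) atTop (𝓝 0)) :
    ∀ᵐ x, x ∈ V 0 → ∃ k, x ∈ V k ∧ x ∉ V (k + 1) ∧ x ∈ ⋃₀ Q k := by
  have h1 : ∀ᵐ x, ∀ k, x ∉ V k \ (V (k + 1) ∪ ⋃₀ Q k) :=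
    ae_all_iff.2 fun k => measure_eq_zero_iff_ae_notMem.1 (h.step k).volume_diff
  have h2 : volume (⋂ k, V k) = 0 :=
    le_antisymm (ge_of_tendsto' h0 fun k => measure_mono (iInter_subset V k)) bot_le
  filter_upwards [h1, measure_eq_zero_iff_ae_notMem.1 h2] with x hx1 hx2 hx0
  by_contra! hn
  refine hx2 (mem_iInter.2 fun k => ?_)
  induction k with
  | zero => exact hx0
  | succ k ih =>
    by_contra hk
    refine hx1 k ⟨ih, ?_⟩
    rintro (h' | h')
    exacts [hk h', hn k ih hk h']

theorem exists_lipschitz (h : SplitSequence S T π L η V w Q) {C₀ : ℝ}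
    (h0 : ∀ x y, ‖w 0 x - w 0 y‖ ≤ C₀ * ‖x - y‖) (k : ℕ) :
    ∃ C, ∀ x y, ‖w k x - w k y‖ ≤ C * ‖x - y‖ := by
  induction k with
  | zero => exact ⟨C₀, h0⟩
  | succ k ih =>
    obtain ⟨C, hC⟩ := ih
    refine ⟨L k + C, fun x y => ?_⟩
    have e : w (k + 1) x - w (k + 1) y =
      (w (k + 1) x - w k x - (w (k + 1) y - w k y)) + (w k x - w k y) := by abel
    rw [e, add_mul]
    exact (norm_add_le _ _).trans (add_le_add ((h.step k).lipschitz x y) (hC x y))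

/-- The Hölder seminorms of the corrections form a geometric series, so the constants stay bounded
although the Lipschitz constants may grow. -/
theorem holder (h : SplitSequence S T π L η V w Q) {A : Set Plane} {C₀ α : ℝ} (hα : 0 < α)
    (hα1 : α < 1) (hL : ∀ k, 0 ≤ L k)
    (h0 : ∀ x ∈ A, ∀ y ∈ A, ‖w 0 x - w 0 y‖ ≤ C₀ * ‖x - y‖ ^ α)
    (hη : ∀ k, L k ^ α * (2 * η k) ^ (1 - α) ≤ (1 / 2) ^ k) (k : ℕ) :
    ∀ x ∈ A, ∀ y ∈ A,
      ‖w k x - w k y‖ ≤ (C₀ + ∑ m ∈ Finset.range k, (1 / 2 : ℝ) ^ m) * ‖x - y‖ ^ α := by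
  intro x hx y hy
  induction k with
  | zero => simpa using h0 x hx y hy
  | succ k ih =>
    have e : w (k + 1) x - w (k + 1) y =
      (w k x - w k y) + (w (k + 1) x - w k x - (w (k + 1) y - w k y)) := by abel
    rw [e, Finset.sum_range_succ, ← add_assoc, add_mul]
    refine (norm_add_le _ _).trans (add_le_add ih ?_)
    have hb : ‖w (k + 1) x - w k x - (w (k + 1) y - w k y)‖ ≤ 2 * η k := by
      have h1 := (h.step k).norm_sub_le x
      have h2 := (h.step k).norm_sub_le y
      linarith [norm_sub_le (w (k + 1) x - w k x) (w (k + 1) y - w k y)]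
    refine (le_rpow_interpolate (norm_nonneg _) (hL k) (norm_nonneg _) hα hα1
      ((h.step k).lipschitz x y) hb).trans ?_
    gcongr
    exact hη k

theorem exists_limit (h : SplitSequence S T π L η V w Q) (hη : ∀ k, η k ≤ (1 / 2) ^ k) :
    ∃ W : Plane → Plane, (∀ x, Tendsto (fun k => w k x) atTop (𝓝 (W x))) ∧
      ∀ k x, dist (w k x) (W x) ≤ 2 * (1 / 2) ^ k := by
  have hd : ∀ x k, dist (w k x) (w (k + 1) x) ≤ 1 * (1 / 2) ^ k := fun x k => by
    rw [dist_comm, dist_eq_norm, one_mul]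
    exact ((h.step k).norm_sub_le x).trans (hη k)
  have hc : ∀ x, ∃ l, Tendsto (fun k => w k x) atTop (𝓝 l) := fun x =>
    cauchySeq_tendsto_of_complete (cauchySeq_of_le_geometric _ _ (by norm_num) (hd x))
  choose W hW using hc
  refine ⟨W, hW, fun k x => ?_⟩
  refine (dist_le_of_le_geometric_of_tendsto _ _ (by norm_num) (hd x) (hW x) k).trans_eq ?_
  ring

/-- Each member of the sequence has its gradients in the sets of the earlier steps. -/
theorem ae_gradient (h : SplitSequence S T π L η V w Q)
    (h0 : Tendsto (fun k => volume (V k)) atTop (𝓝 0)) (k : ℕ) :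
    ∀ᵐ x, x ∈ V 0 → ∃ m, x ∈ V m ∧ ∃ X ∈ S m ∪ T m, ∃ b, ∀ᶠ y in 𝓝 x, w k y = affineMap X b y := by
  filter_upwards [h.ae_mem h0] with x hx hx0
  obtain ⟨m, hm, hm', q, hq, hxq⟩ := hx hx0
  rcases le_or_gt k m with hkm | hmk
  · obtain ⟨X, hX, b, hb⟩ := h.gradient k x (h.antitone hkm hm)
    exact ⟨k, h.antitone hkm hm, X, Or.inl hX, b, hb⟩
  · obtain ⟨Y, hY, b, hb⟩ := (h.step m).affine q hq
    refine ⟨m, hm, Y, Or.inr hY, b, ?_⟩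
    filter_upwards [((h.step m).isRegularDomain q hq).isOpen.mem_nhds hxq] with y hy
    rw [← hb y hy]
    exact h.eq_of_notMem (disjoint_left.1 ((h.step m).disjoint q hq) hy) hmk

end SplitSequence

/-! ### Pointwise gradients and the passage to the limit -/

/-- The pointwise gradient of `w`, through its directional derivatives. -/
def lineGradient (w : Plane → Plane) (x : Plane) : Mat :=
  Matrix.of fun i j => lineDeriv ℝ (fun y => w y i) x (EuclideanSpace.single j 1)

theorem lineGradient_eq {w : Plane → Plane} {x : Plane} {X : Mat} {b : Plane}
    (h : ∀ᶠ y in 𝓝 x, w y = affineMap X b y) : lineGradient w x = X := by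
  ext i j
  exact lineDeriv_of_eventually_eq_affineMap h i j

theorem lineGradient_congr {w w' : Plane → Plane} {x : Plane} (h : w =ᶠ[𝓝 x] w') :
    lineGradient w x = lineGradient w' x := by
  ext i j
  have hi : (fun y => w y i) =ᶠ[𝓝 x] fun y => w' y i := by
    filter_upwards [h] with y hy
    rw [hy]
  exact hi.lineDeriv_eq

theorem measurable_lineGradient {w : Plane → Plane} (hw : Continuous w) (i j : Fin 2) :
    Measurable fun x => lineGradient w x i j :=
  measurable_lineDeriv (by fun_prop : Continuous fun y => w y i)

/-- Integrable majorant which dominates `N k` on `V k`. -/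
theorem exists_integrable_majorant {V : ℕ → Set Plane} (hV : ∀ k, MeasurableSet (V k)) {N : ℕ → ℝ}
    (hN : ∀ k, 0 ≤ N k) (hfin : ∑' k, ENNReal.ofReal (N k) * volume (V k) ≠ ⊤) :
    ∃ H : Plane → ℝ, Integrable H ∧ ∀ᵐ x, ∀ k, x ∈ V k → N k ≤ H x := by
  -- A sum instead of a supremum: its integral is computed term by term and still dominates each `N
  -- k` on `V k`.
  let H : Plane → ℝ≥0∞ := fun x => ∑' k, (V k).indicator (fun _ => ENNReal.ofReal (N k)) x
  have hm : ∀ k, Measurable ((V k).indicator fun _ : Plane => ENNReal.ofReal (N k)) :=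
    fun k => measurable_const.indicator (hV k)
  have hH : Measurable H := Measurable.tsum hm
  have hint : ∫⁻ x, H x ≠ ⊤ := by
    rw [lintegral_tsum fun k => (hm k).aemeasurable]
    simpa only [lintegral_indicator_const (hV _)] using hfin
  refine ⟨fun x => (H x).toReal, integrable_toReal_of_lintegral_ne_top hH.aemeasurable hint, ?_⟩
  filter_upwards [ae_lt_top hH hint] with x hx k hk
  have h1 : ENNReal.ofReal (N k) ≤ H x := by
    refine le_trans ?_ (ENNReal.le_tsum k)
    rw [indicator_of_mem hk]
  rw [← ENNReal.toReal_ofReal (hN k)]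
  exact ENNReal.toReal_mono hx.ne h1

/-- Limits of maps with integrably dominated gradients. -/
theorem hasWeakGradientL1_of_tendsto {Ω : Set Plane} (hΩ : IsOpen Ω)
    {w : ℕ → Plane → Plane} {W : Plane → Plane}
    (hlip : ∀ k, ∃ C, ∀ x y, ‖w k x - w k y‖ ≤ C * ‖x - y‖)
    (hW : Continuous W) (hlim : ∀ x, Tendsto (fun k => w k x) atTop (𝓝 (W x)))
    {B H : Plane → ℝ} (hB : IntegrableOn B Ω) (hwB : ∀ k, ∀ x ∈ Ω, ‖w k x‖ ≤ B x)
    (hH : IntegrableOn H Ω)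
    (hwH : ∀ k, ∀ᵐ x, x ∈ Ω → ∀ i j, |lineGradient (w k) x i j| ≤ H x)
    (hG : ∀ᵐ x, x ∈ Ω → ∀ᶠ k in atTop, lineGradient (w k) x = lineGradient W x) :
    HasWeakGradientL1 Ω W (lineGradient W) := by
  have hwc : ∀ k, ∀ i, ∃ C, LipschitzWith C fun x => w k x i := fun k i => by
    obtain ⟨C, hC⟩ := hlip k
    refine ⟨C.toNNReal, lipschitzWith_of_abs_sub_le fun x y => ?_⟩
    exact (abs_apply_le_norm (w k x - w k y) i).trans (hC x y)
  have hwcont : ∀ k, Continuous (w k) := fun k => by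
    obtain ⟨C, hC⟩ := hlip k
    exact (LipschitzWith.of_dist_le' (K := C) fun x y => by
      rw [dist_eq_norm, dist_eq_norm]; exact hC x y).continuous
  have hWB : ∀ x ∈ Ω, ‖W x‖ ≤ B x := fun x hx =>
    le_of_tendsto' (hlim x).norm fun k => hwB k x hx
  have hWH : ∀ᵐ x ∂volume.restrict Ω, ∀ i j, |lineGradient W x i j| ≤ H x := by
    rw [ae_restrict_iff' hΩ.measurableSet]
    filter_upwards [ae_all_iff.2 hwH, hG] with x h1 h2 hx
    obtain ⟨k, hk⟩ := (h2 hx).exists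
    rw [← hk]
    exact h1 k hx
  refine ⟨fun i => ?_, fun i j => ?_, fun φ hφ hc hs i j => ?_⟩
  · refine hB.mono' (by fun_prop) ?_
    filter_upwards [ae_restrict_mem hΩ.measurableSet] with x hx
    exact (abs_apply_le_norm _ i).trans (hWB x hx)
  · refine hH.mono' (measurable_lineGradient hW i j).aestronglyMeasurable ?_
    filter_upwards [hWH] with x hx
    exact hx i j
  · have hφ1 : ContDiff ℝ 1 φ := hφ.of_le (by exact_mod_cast le_top)
    obtain ⟨D, hD⟩ := hφ1.lipschitzWith_of_hasCompactSupport hc one_ne_zero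
    obtain ⟨M, hM⟩ := hc.exists_bound_of_continuous hφ.continuous
    have hφc : Continuous φ := hφ.continuous
    have hdc : Continuous fun x => fderiv ℝ φ x (EuclideanSpace.single j 1) :=
      (hφ1.continuous_fderiv one_ne_zero).clm_apply continuous_const
    have hd : ∀ x, |fderiv ℝ φ x (EuclideanSpace.single j 1)| ≤ D := fun x => by
      have h1 := (fderiv ℝ φ x).le_opNorm (EuclideanSpace.single j (1 : ℝ))
      have h2 := norm_fderiv_le_of_lipschitz ℝ hD (x₀ := x)
      rw [PiLp.norm_single, norm_one, mul_one] at h1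
      exact h1.trans h2
    have t1 : Tendsto (fun k => ∫ x in Ω, w k x i * fderiv ℝ φ x (EuclideanSpace.single j 1)) atTop
        (𝓝 (∫ x in Ω, W x i * fderiv ℝ φ x (EuclideanSpace.single j 1))) := by
      refine tendsto_integral_of_dominated_convergence (fun x => B x * D) (fun k => ?_)
        (hB.mul_const _) (fun k => ?_) (Eventually.of_forall fun x => ?_)
      · exact (((by fun_prop : Continuous fun x => w k x i)).mul hdc).aestronglyMeasurable
      · filter_upwards [ae_restrict_mem hΩ.measurableSet] with x hx
        rw [norm_mul]
        have h1 := (abs_apply_le_norm (w k x) i).trans (hwB k x hx)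
        exact mul_le_mul h1 (hd x) (norm_nonneg _) ((abs_nonneg _).trans h1)
      · refine Tendsto.mul_const _ ?_
        exact ((by fun_prop : Continuous fun z : Plane => z i).tendsto (W x)).comp (hlim x)
    have t2 : Tendsto (fun k => ∫ x in Ω, lineGradient (w k) x i j * φ x) atTop
        (𝓝 (∫ x in Ω, lineGradient W x i j * φ x)) := by
      refine tendsto_integral_of_dominated_convergence (fun x => H x * M) (fun k => ?_)
        (hH.mul_const _) (fun k => ?_) ?_
      · exact ((measurable_lineGradient (hwcont k) i j).mul hφc.measurable).aestronglyMeasurable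
      · rw [ae_restrict_iff' hΩ.measurableSet]
        filter_upwards [hwH k] with x h1 hx
        rw [norm_mul]
        exact mul_le_mul (h1 hx i j) (hM x) (norm_nonneg _) ((abs_nonneg _).trans (h1 hx i j))
      · rw [ae_restrict_iff' hΩ.measurableSet]
        filter_upwards [hG] with x h1 hx
        refine tendsto_const_nhds.congr' ?_
        filter_upwards [h1 hx] with k hk
        rw [hk]
    -- The limit need not be Lipschitz, so integration by parts is applied to each approximant and
    -- both sides are passed to the limit.
    refine tendsto_nhds_unique t1 (t2.neg.congr fun k => ?_)
    obtain ⟨C, hC⟩ := hwc k i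
    exact (setIntegral_mul_fderiv_eq_neg hC hφ hc hs _).symm

/-- Infinitely many successive splittings produce a piecewise affine map whose gradients lie in the
sets `T k`. -/
theorem exists_limit_map {S T : ℕ → Set Mat} {π L N : ℕ → ℝ}
    (hsplit : ∀ k, CanSplit (S k) (T k) (S (k + 1)) (π k) (L k)) (hL : ∀ k, 0 ≤ L k)
    (hN : ∀ k, 1 ≤ N k) (hNb : ∀ k, ∀ X ∈ S k ∪ T k, ∀ i j, |X i j| ≤ N k) (hπ : ∀ k, 0 ≤ π k)
    (hsum : Summable fun k => N k * ∏ m ∈ Finset.range k, π m) {Ω : Set Plane}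
    (hΩ : IsRegularDomain Ω) {X₀ : Mat} (hX₀ : X₀ ∈ S 0) (b : Plane) {α : ℝ≥0} (hα : 0 < α)
    (hα1 : α < 1) :
    ∃ (W : Plane → Plane) (G : Plane → Mat) (V : ℕ → Set Plane),
      HasWeakGradientL1 Ω W G ∧ IsPiecewiseAffineOn Ω W ∧
      (∃ C : ℝ≥0, HolderOnWith C α W (closure Ω)) ∧
      (∀ x ∈ frontier Ω, W x = affineMap X₀ b x) ∧
      Antitone V ∧ V 0 = Ω ∧
      (∀ k, volume (V k) = ENNReal.ofReal (∏ m ∈ Finset.range k, π m) * volume Ω) ∧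
      ∀ᵐ x, x ∈ Ω → ∃ k, x ∈ V k ∧ x ∉ V (k + 1) ∧ G x ∈ T k := by
  have hα0' : (0 : ℝ) < α := hα
  have hα1' : (α : ℝ) < 1 := hα1
  choose η hη0 hη1 hη2 using fun k => exists_small_amplitude (L k) hα1'
    (by positivity : (0 : ℝ) < (1 / 2) ^ k)
  have hw₀ : HasLocalGradientIn (S 0) Ω (affineMap X₀ b) := fun x _ =>
    ⟨X₀, hX₀, b, Eventually.of_forall fun _ => rfl⟩
  obtain ⟨V, w, Q, hV0, hw0, hVo, hgrad, hstep⟩ :=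
    exists_split_sequence hsplit hη0 hΩ.isOpen hΩ.isBounded hw₀
  have h : SplitSequence S T π L η V w Q := ⟨hVo, hgrad, hstep⟩
  have hVΩ : ∀ k, V k ⊆ Ω := fun k => hV0 ▸ h.antitone (Nat.zero_le k)
  have hΩfin : volume Ω ≠ ⊤ := hΩ.isBounded.measure_lt_top.ne
  set P : ℕ → ℝ := fun k => ∏ m ∈ Finset.range k, π m with hP
  have hP0 : ∀ k, 0 ≤ P k := fun k => Finset.prod_nonneg fun m _ => hπ m
  have hvol : ∀ k, volume (V k) = ENNReal.ofReal (P k) * volume Ω := fun k => by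
    rw [← ENNReal.ofReal_toReal (measure_ne_top_of_subset (hVΩ k) hΩfin), ← measureReal_def,
      h.volume_real, hV0, ENNReal.ofReal_mul (hP0 k), measureReal_def, ENNReal.ofReal_toReal hΩfin]
  have hPt : Tendsto P atTop (𝓝 0) :=
    -- As `N k ≥ 1`, the summability hypothesis already forces the active volume to tend to zero.
    squeeze_zero hP0 (fun k => le_mul_of_one_le_left (hP0 k) (hN k)) hsum.tendsto_atTop_zero
  have hvol0 : Tendsto (fun k => volume (V k)) atTop (𝓝 0) := by
    have h1 := ENNReal.Tendsto.mul_const (ENNReal.tendsto_ofReal hPt) (Or.inr hΩfin)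
    simp only [ENNReal.ofReal_zero, zero_mul] at h1
    exact h1.congr fun k => (hvol k).symm
  obtain ⟨W, hlim, hdist⟩ := h.exists_limit hη1
  obtain ⟨C₀, hC₀, hlip0⟩ := exists_norm_affineMap_sub_le X₀ b
  have hlip : ∀ k, ∃ C, ∀ x y, ‖w k x - w k y‖ ≤ C * ‖x - y‖ :=
    h.exists_lipschitz (C₀ := C₀) (by rw [hw0]; exact hlip0)
  have hwcont : ∀ k, Continuous (w k) := fun k => by
    obtain ⟨C, hC⟩ := hlip k
    exact (LipschitzWith.of_dist_le' (K := C) fun x y => by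
      rw [dist_eq_norm, dist_eq_norm]; exact hC x y).continuous
  have hW : Continuous W := by
    refine TendstoUniformly.continuous (F := w) (p := atTop) ?_ (Frequently.of_forall hwcont)
    rw [Metric.tendstoUniformly_iff]
    intro ε hε
    have h1 : Tendsto (fun k : ℕ => 2 * (1 / 2 : ℝ) ^ k) atTop (𝓝 0) := by
      simpa using (tendsto_pow_atTop_nhds_zero_of_lt_one (by norm_num)
        (by norm_num : (1 / 2 : ℝ) < 1)).const_mul 2
    filter_upwards [h1.eventually_lt_const hε] with k hk x
    rw [dist_comm]
    exact (hdist k x).trans_lt hk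
  have hWeq : ∀ k, ∀ x ∉ V k, W x = w k x := fun k x hx => by
    refine tendsto_nhds_unique (hlim x) (tendsto_const_nhds.congr' ?_)
    filter_upwards [eventually_ge_atTop k] with m hm
    exact (h.eq_of_notMem hx hm).symm
  have hQ : ∀ k, ∀ q ∈ Q k, ∀ y ∈ q, y ∉ V (k + 1) := fun k q hq y hy =>
    disjoint_left.1 ((h.step k).disjoint q hq) hy
  have hWaff : ∀ k, ∀ q ∈ Q k, ∃ Y ∈ T k, ∃ b, ∀ y ∈ q, W y = affineMap Y b y := by
    intro k q hq
    obtain ⟨Y, hY, c, hc⟩ := (h.step k).affine q hq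
    exact ⟨Y, hY, c, fun y hy => by rw [hWeq (k + 1) y (hQ k q hq y hy), hc y hy]⟩
  have hae := h.ae_mem hvol0
  rw [hV0] at hae
  have hbdd : ∃ R, ∀ x ∈ closure Ω, ‖x‖ ≤ R := hΩ.isBounded.closure.exists_norm_le
  obtain ⟨R, hR⟩ := hbdd
  refine ⟨W, lineGradient W, V, ?_, ?_, ?_, ?_, h.antitone, hV0, hvol, ?_⟩
  · have hfin : ∑' k, ENNReal.ofReal (N k) * volume (V k) ≠ ⊤ := by
      have e : ∀ k, ENNReal.ofReal (N k) * volume (V k) =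
          ENNReal.ofReal (N k * P k) * volume Ω := fun k => by
        rw [hvol, ← mul_assoc, ENNReal.ofReal_mul (zero_le_one.trans (hN k))]
      simp only [e]
      rw [ENNReal.tsum_mul_right]
      exact ENNReal.mul_ne_top hsum.tsum_ofReal_ne_top hΩfin
    obtain ⟨H, hH, hHb⟩ := exists_integrable_majorant (fun k => (hVo k).measurableSet)
      (fun k => zero_le_one.trans (hN k)) hfin
    refine hasWeakGradientL1_of_tendsto hΩ.isOpen hlip hW hlim (B := fun x => ‖W x‖ + 2) (H := H)
      ?_ ?_ hH.integrableOn ?_ ?_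
    · have hc : IntegrableOn (fun x => ‖W x‖ + 2) (closure Ω) :=
        (by fun_prop : Continuous fun x => ‖W x‖ + 2).continuousOn.integrableOn_compact
          hΩ.isBounded.isCompact_closure
      exact hc.mono_set subset_closure
    · intro k x _
      have h1 := hdist k x
      have h2 : (1 / 2 : ℝ) ^ k ≤ 1 := pow_le_one₀ (by norm_num) (by norm_num)
      rw [dist_eq_norm] at h1
      have h3 := norm_le_norm_add_norm_sub' (w k x) (W x)
      linarith
    · intro k
      have hgk := h.ae_gradient hvol0 k
      rw [hV0] at hgk
      filter_upwards [hgk, hHb] with x h1 h2 hx i j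
      obtain ⟨m, hm, X, hX, c, hc⟩ := h1 hx
      rw [lineGradient_eq hc]
      exact (hNb m X hX i j).trans (h2 m hm)
    · filter_upwards [hae] with x h1 hx
      obtain ⟨m, -, -, q, hq, hxq⟩ := h1 hx
      -- After its exit at step `m` the map is no longer changed on the open piece `q`, so the
      -- gradients stabilise.
      filter_upwards [eventually_ge_atTop (m + 1)] with k hk
      refine lineGradient_congr ?_
      filter_upwards [((h.step m).isRegularDomain q hq).isOpen.mem_nhds hxq] with y hy
      rw [hWeq (m + 1) y (hQ m q hq y hy), h.eq_of_notMem (hQ m q hq y hy) hk]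
  · refine ⟨⋃ k, Q k, countable_iUnion fun k => (h.step k).countable, ?_, ?_, ?_, ?_⟩
    · intro q hq q' hq' hne
      obtain ⟨k, hk⟩ := mem_iUnion.1 hq
      obtain ⟨k', hk'⟩ := mem_iUnion.1 hq'
      have key : ∀ k k' q q', q ∈ Q k → q' ∈ Q k' → k < k' → Disjoint q q' := by
        intro k k' q q' hk hk' hlt
        refine disjoint_left.2 fun y hy hy' => hQ k q hk y hy ?_
        exact h.antitone hlt ((h.step k').subset_of_mem q' hk' hy')
      rcases lt_trichotomy k k' with hlt | rfl | hlt
      · exact key k k' q q' hk hk' hlt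
      · exact (h.step k).pairwiseDisjoint hk hk' hne
      · exact (key k' k q' q hk' hk hlt).symm
    · intro q hq
      obtain ⟨k, hk⟩ := mem_iUnion.1 hq
      exact ⟨(h.step k).isRegularDomain q hk, ((h.step k).subset_of_mem q hk).trans (hVΩ k)⟩
    · rw [measure_eq_zero_iff_ae_notMem]
      filter_upwards [hae] with x h1 hx
      obtain ⟨m, -, -, q, hq, hxq⟩ := h1 hx.1
      exact hx.2 ⟨q, mem_iUnion.2 ⟨m, hq⟩, hxq⟩
    · intro q hq
      obtain ⟨k, hk⟩ := mem_iUnion.1 hq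
      obtain ⟨Y, -, c, hc⟩ := hWaff k q hk
      exact ⟨Y, c, hc⟩
  · have hw0h : ∀ x ∈ closure Ω, ∀ y ∈ closure Ω, ‖w 0 x - w 0 y‖ ≤
        C₀ ^ (α : ℝ) * (C₀ * (2 * R)) ^ (1 - (α : ℝ)) * ‖x - y‖ ^ (α : ℝ) := by
      intro x hx y hy
      rw [hw0]
      refine le_rpow_interpolate (norm_nonneg _) hC₀ (norm_nonneg _) hα0' hα1' (hlip0 x y) ?_
      refine (hlip0 x y).trans (mul_le_mul_of_nonneg_left ?_ hC₀)
      linarith [norm_sub_le x y, hR x hx, hR y hy]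
    set C₁ := C₀ ^ (α : ℝ) * (C₀ * (2 * R)) ^ (1 - (α : ℝ))
    refine ⟨(C₁ + 2).toNNReal, holderOnWith_of_norm_sub_le fun x hx y hy => ?_⟩
    refine le_of_tendsto' ((hlim x).sub (hlim y)).norm fun k => ?_
    refine (h.holder hα0' hα1' hL hw0h hη2 k x hx y hy).trans ?_
    gcongr
    exact sum_geometric_two_le k
  · intro x hx
    rw [hWeq 0 x, hw0]
    rw [hV0]
    exact fun hx' => (hΩ.isOpen.inter_frontier_eq ▸ ⟨hx', hx⟩ : x ∈ (∅ : Set Plane))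
  · filter_upwards [hae] with x h1 hx
    obtain ⟨m, hm, hm', q, hq, hxq⟩ := h1 hx
    refine ⟨m, hm, hm', ?_⟩
    obtain ⟨Y, hY, c, hc⟩ := hWaff m q hq
    rw [lineGradient_eq (X := Y) (b := c)]
    · exact hY
    · filter_upwards [((h.step m).isRegularDomain q hq).isOpen.mem_nhds hxq] with y hy
      exact hc y hy

/-! ### The staircase: diagonal entries and proportions -/

/-- The diagonal entries along the staircase: at step `k` the entry `stair a d k` is replaced by
`stair a d (k + 2)`, while the other diagonal entry is `stair a d (k + 1)`. -/
def stair (a d : ℝ) : ℕ → ℝ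
  | 0 => a
  | 1 => d
  -- Once the first two entries have been replaced, each diagonal entry grows by one whenever it
  -- moves. Starting above `max a d` makes the sequence monotone from index 1 on, whichever of `a`
  -- and `d` is larger.
  | k + 2 => max a d + 1 + k / 2

/-- The proportion of the domain which moves on at step `k`. -/
def stairRatio (θ a d : ℝ) (k : ℕ) : ℝ :=
  (stair a d k - θ * stair a d (k + 1)) /
    (stair a d (k + 2) - stair a d k + (stair a d k - θ * stair a d (k + 1)))

/-- Bernoulli's inequality with increment `-1/y`. It bounds a proportion by a power whose product
over the steps telescopes; `rpow_le_div_add` is the counterpart from below. -/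
theorem sub_div_le_rpow {y p : ℝ} (hy : 1 ≤ y) (hp : 1 ≤ p) : (y - p) / y ≤ ((y - 1) / y) ^ p := by
  have hy0 : 0 < y := by linarith
  have h := one_add_mul_self_le_rpow_one_add (s := -(1 / y)) (p := p)
    (by rw [neg_le_neg_iff, div_le_one hy0]; exact hy) hp
  have e1 : (y - p) / y = 1 + p * -(1 / y) := by field_simp; ring
  have e2 : (y - 1) / y = 1 + -(1 / y) := by field_simp; ring
  rw [e1, e2]
  exact h

theorem rpow_le_div_add {y p : ℝ} (hy : 0 < y) (hp : 1 ≤ p) : (y / (y + 1)) ^ p ≤ y / (y + p) := by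
  have h := one_add_mul_self_le_rpow_one_add (s := 1 / y) (p := p)
    (by have : 0 < 1 / y := by positivity
        linarith) hp
  have e1 : y / (y + p) = (1 + p * (1 / y))⁻¹ := by
    rw [← inv_div]; congr 1; field_simp
  have e2 : y / (y + 1) = (1 + 1 / y)⁻¹ := by
    rw [← inv_div]; congr 1; field_simp
  rw [e1, e2, Real.inv_rpow (by positivity)]
  exact inv_anti₀ (by positivity) h

section

variable {a d κ : ℝ}

theorem stair_succ_mono : Monotone fun k => stair a d (k + 1) := by
  refine monotone_nat_of_le_succ fun k => ?_
  cases k with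
  | zero => simp only [stair]; push_cast; linarith [le_max_right a d]
  | succ k => simp only [stair]; push_cast; linarith

theorem stair_lt_add_two (k : ℕ) : stair a d k < stair a d (k + 2) := by
  rcases k with _ | _ | k
  · simp only [stair]; push_cast; linarith [le_max_left a d]
  · simp only [stair]; push_cast; linarith [le_max_right a d]
  · simp only [stair]; push_cast; linarith

/-- The starting diagonal matrices: large, with nearly equal entries. -/
structure IsStairStart (κ a d : ℝ) : Prop where
  one_lt : 1 < κ
  lt_left : 4 * κ < a
  lt_right : 4 * κ < d
  left_le : a ≤ d + d / (4 * κ)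
  le_left : d - d / (4 * κ) ≤ a

namespace IsStairStart

theorem top_le (h : IsStairStart κ a d) : max a d + 1 ≤ d + d / (2 * κ) := by
  have hκ := h.one_lt
  have h1 : 1 ≤ d / (4 * κ) := by rw [le_div_iff₀ (by linarith)]; linarith [h.lt_right]
  have h2 : d / (2 * κ) = d / (4 * κ) + d / (4 * κ) := by field_simp; ring
  have h3 : max a d ≤ d + d / (4 * κ) := max_le h.left_le (by linarith)
  linarith

theorem lt_stair (h : IsStairStart κ a d) (k : ℕ) : 4 * κ < stair a d k := by
  rcases k with _ | k
  · exact h.lt_left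
  · exact h.lt_right.trans_le (stair_succ_mono (a := a) (d := d) (Nat.zero_le k))

theorem stairRatio_add_two (h : IsStairStart κ a d) (k : ℕ) :
    stairRatio (1 - 1 / κ) a d (k + 2) =
      (2 * max a d + 3 + k - κ) / (2 * max a d + 3 + k + κ) := by
  have hκ : 0 < κ := by linarith [h.one_lt]
  have hS : 0 ≤ max a d := by linarith [h.lt_left, le_max_left a d]
  simp only [stairRatio, stair]
  push_cast
  have e1 : max a d + 1 + (k : ℝ) / 2 - (1 - 1 / κ) * (max a d + 1 + ((k : ℝ) + 1) / 2) =
      (2 * max a d + 3 + k - κ) / (2 * κ) := by field_simp; ring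
  have e2 : max a d + 1 + ((k : ℝ) + 2) / 2 - (max a d + 1 + (k : ℝ) / 2) +
      (2 * max a d + 3 + k - κ) / (2 * κ) = (2 * max a d + 3 + k + κ) / (2 * κ) := by
    field_simp; ring
  rw [e1, e2]
  field_simp

/-- The final value lies below the current one: the relative gap `1/κ` exceeds the anisotropy of the
start, and later, as entries exceed `4κ`, it exceeds the increment `1/2`. -/
theorem sub_pos (h : IsStairStart κ a d) (k : ℕ) :
    0 < stair a d k - (1 - 1 / κ) * stair a d (k + 1) := by
  have hκ := h.one_lt
  have hd := h.lt_right
  have hdκ : 0 < d / κ := by have : 0 < d := by linarith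
                             positivity
  have e4 : d / (4 * κ) = d / κ / 4 := by field_simp
  have e2 : d / (2 * κ) = d / κ / 2 := by field_simp
  rcases k with _ | _ | k
  · simp only [stair]
    have e : a - (1 - 1 / κ) * d = a - d + d / κ := by ring
    rw [e]
    linarith [h.le_left]
  · simp only [stair]
    push_cast
    have h1 := h.top_le
    have h2 : d / κ ≤ (max a d + 1) / κ := by gcongr; linarith [le_max_right a d]
    have e : d - (1 - 1 / κ) * (max a d + 1 + 0 / 2) = d - (max a d + 1) + (max a d + 1) / κ := by
      ring
    rw [e]
    linarith
  · have hs := h.lt_stair (k + 2)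
    have e' : stair a d (k + 2 + 1) = stair a d (k + 2) + 1 / 2 := by
      simp only [stair]; push_cast; ring
    rw [e']
    have h3 : 4 ≤ (stair a d (k + 2) + 1 / 2) / κ := by
      rw [le_div_iff₀ (by linarith)]; linarith
    have e : stair a d (k + 2) - (1 - 1 / κ) * (stair a d (k + 2) + 1 / 2) =
        (stair a d (k + 2) + 1 / 2) / κ - 1 / 2 := by ring
    rw [e]
    linarith

theorem stairRatio_pos (h : IsStairStart κ a d) (k : ℕ) : 0 < stairRatio (1 - 1 / κ) a d k :=
  div_pos (h.sub_pos k)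
    (add_pos (_root_.sub_pos.2 (stair_lt_add_two k)) (h.sub_pos k))

theorem stairRatio_le_one (h : IsStairStart κ a d) (k : ℕ) :
    stairRatio (1 - 1 / κ) a d k ≤ 1 := by
  have h1 := h.sub_pos k
  have h2 := stair_lt_add_two (a := a) (d := d) k
  refine (div_le_one ?_).2 ?_ <;> linarith

/-- The closed form of the proportions begins at index 2, so the first two are bounded by hand. The
bound does not depend on `a` and `d`, as a uniform `m₀` requires. -/
theorem le_stairRatio_zero (h : IsStairStart κ a d) :
    1 / (4 * κ) ≤ stairRatio (1 - 1 / κ) a d 0 := by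
  have hκ := h.one_lt
  have hd := h.lt_right
  have hp := h.sub_pos 0
  have hlt := stair_lt_add_two (a := a) (d := d) 0
  have hdκ : 0 < d / κ := by have : 0 < d := by linarith
                             positivity
  have e4 : d / (4 * κ) = d / κ / 4 := by field_simp
  have e2 : d / (2 * κ) = d / κ / 2 := by field_simp
  have hdd : d / κ ≤ d := div_le_self (by linarith) hκ.le
  have h1 := h.top_le
  have h2 := h.le_left
  rw [stairRatio, div_le_div_iff₀ (by linarith) (by linarith)]
  simp only [stair, Nat.cast_zero, zero_div, add_zero] at hp hlt ⊢
  have e : a - (1 - 1 / κ) * d = a - d + d / κ := by ring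
  rw [e] at hp ⊢
  have h3 : max a d + 1 - a + (a - d + d / κ) ≤ 2 * d := by linarith
  have h4 : 3 / 4 * (d / κ) ≤ a - d + d / κ := by linarith
  have h5 : (3 / 4 * (d / κ)) * (4 * κ) = 3 * d := by field_simp
  nlinarith

theorem le_stairRatio_one (h : IsStairStart κ a d) :
    1 / (4 * κ) ≤ stairRatio (1 - 1 / κ) a d 1 := by
  have hκ := h.one_lt
  have hd := h.lt_right
  have hp := h.sub_pos 1
  have hlt := stair_lt_add_two (a := a) (d := d) 1
  have hdκ : 4 ≤ d / κ := by rw [le_div_iff₀ (by linarith)]; linarith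
  have e2 : d / (2 * κ) = d / κ / 2 := by field_simp
  have hdd : d / κ ≤ d := div_le_self (by linarith) hκ.le
  have h1 := h.top_le
  have h2 : d / κ ≤ (max a d + 1) / κ := by gcongr; linarith [le_max_right a d]
  have h6 : (max a d + 1) / κ ≤ max a d + 1 :=
    div_le_self (by linarith [le_max_right a d]) hκ.le
  rw [stairRatio, div_le_div_iff₀ (by linarith) (by linarith)]
  simp only [stair, Nat.cast_zero, Nat.cast_one, zero_div, add_zero] at hp hlt ⊢
  have e : d - (1 - 1 / κ) * (max a d + 1) = d - (max a d + 1) + (max a d + 1) / κ := by ring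
  rw [e] at hp ⊢
  have h3 : max a d + 1 + 1 / 2 - d + (d - (max a d + 1) + (max a d + 1) / κ) ≤ 2 * d := by
    linarith
  have h4 : 1 / 2 * (d / κ) ≤ d - (max a d + 1) + (max a d + 1) / κ := by linarith
  have h5 : (1 / 2 * (d / κ)) * (4 * κ) = 2 * d := by field_simp; ring
  nlinarith

theorem prod_le (h : IsStairStart κ a d) (m : ℕ) :
    ∏ k ∈ Finset.range (m + 2), stairRatio (1 - 1 / κ) a d k ≤
      ((2 * max a d + 2 + κ) / (2 * max a d + 2 + κ + m)) ^ (2 * κ) := by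
  have hκ := h.one_lt
  have hS : 0 ≤ max a d := by linarith [h.lt_left, le_max_left a d]
  set A := 2 * max a d + 2 + κ with hA
  have hA0 : 0 < A := by linarith
  induction m with
  | zero =>
    rw [Nat.cast_zero, add_zero, div_self hA0.ne', Real.one_rpow]
    -- The two irregular initial proportions are bounded by 1; decay is only extracted afterwards.
    exact Finset.prod_le_one (fun k _ => (h.stairRatio_pos k).le) fun k _ => h.stairRatio_le_one k
  | succ m ih =>
    rw [show m + 1 + 2 = (m + 2) + 1 from rfl, Finset.prod_range_succ, h.stairRatio_add_two]
    have hm : (0 : ℝ) ≤ m := m.cast_nonneg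
    have h1 := sub_div_le_rpow (y := A + m + 1) (p := 2 * κ) (by linarith) (by linarith)
    have e1 : (2 * max a d + 3 + m - κ) / (2 * max a d + 3 + m + κ) =
        (A + m + 1 - 2 * κ) / (A + m + 1) := by rw [hA]; congr 1 <;> ring
    have h2 : 0 ≤ (A + m + 1 - 2 * κ) / (A + m + 1) := by
      rw [← e1, ← h.stairRatio_add_two]; exact (h.stairRatio_pos _).le
    rw [e1]
    refine (mul_le_mul ih h1 h2 (by positivity)).trans_eq ?_
    rw [← Real.mul_rpow (by positivity) (div_nonneg (by linarith) (by linarith))]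
    congr 1
    push_cast
    have : A + m ≠ 0 := by positivity
    have : A + m + 1 ≠ 0 := by positivity
    field_simp
    ring

theorem le_prod (h : IsStairStart κ a d) (m : ℕ) :
    1 / (4 * κ) * (1 / (4 * κ)) *
      ((2 * max a d + 3 - κ) / (2 * max a d + 3 - κ + m)) ^ (2 * κ) ≤
      ∏ k ∈ Finset.range (m + 2), stairRatio (1 - 1 / κ) a d k := by
  have hκ := h.one_lt
  have hS : 4 * κ ≤ max a d := h.lt_left.le.trans (le_max_left a d)
  set B := 2 * max a d + 3 - κ with hB
  have hB0 : 0 < B := by linarith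
  induction m with
  | zero =>
    rw [Nat.cast_zero, add_zero, div_self hB0.ne', Real.one_rpow, mul_one,
      Finset.prod_range_succ, Finset.prod_range_one]
    have := h.le_stairRatio_zero
    have := h.le_stairRatio_one
    have := h.stairRatio_pos 0
    gcongr
  | succ m ih =>
    rw [show m + 1 + 2 = (m + 2) + 1 from rfl, Finset.prod_range_succ, h.stairRatio_add_two]
    have hm : (0 : ℝ) ≤ m := m.cast_nonneg
    have h1 := rpow_le_div_add (y := B + m) (p := 2 * κ) (by linarith) (by linarith)
    have e1 : (2 * max a d + 3 + m - κ) / (2 * max a d + 3 + m + κ) =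
        (B + m) / (B + m + 2 * κ) := by rw [hB]; congr 1 <;> ring
    rw [e1]
    refine le_trans (le_of_eq ?_) (mul_le_mul ih h1 (by positivity)
      (Finset.prod_nonneg fun k _ => (h.stairRatio_pos k).le))
    rw [mul_assoc (1 / (4 * κ) * (1 / (4 * κ))), ← Real.mul_rpow (by positivity) (by positivity)]
    congr 2
    push_cast
    field_simp
    ring

theorem summable_mul_prod (h : IsStairStart κ a d) :
    Summable fun k => stair a d (k + 2) * ∏ m ∈ Finset.range k, stairRatio (1 - 1 / κ) a d m := by
  have hκ := h.one_lt
  have hS : 0 ≤ max a d := by linarith [h.lt_left, le_max_left a d]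
  rw [← summable_nat_add_iff 2]
  set A := 2 * max a d + 2 + κ with hA
  have hA0 : 0 < A := by linarith
  -- Linear growth of the entries against decay of order `2κ`: the exponent `1 - 2κ` is below `-1`
  -- precisely because `κ > 1`.
  have hsum : Summable fun m : ℕ => 2 * A ^ (2 * κ) * ((m + 1 : ℕ) : ℝ) ^ (1 - 2 * κ) :=
    (((summable_nat_add_iff 1).2 (Real.summable_nat_rpow.2 (by linarith)))).mul_left _
  refine Summable.of_nonneg_of_le (fun m => ?_) (fun m => ?_) hsum
  · exact mul_nonneg (by linarith [h.lt_stair (m + 2 + 2)])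
      (Finset.prod_nonneg fun k _ => (h.stairRatio_pos k).le)
  · have hm : (0 : ℝ) ≤ m := m.cast_nonneg
    have h1 : stair a d (m + 2 + 2) ≤ 2 * (A + m) := by
      simp only [stair]; push_cast; linarith
    have h2 : (A + m) ^ (1 - 2 * κ) ≤ ((m + 1 : ℕ) : ℝ) ^ (1 - 2 * κ) := by
      apply Real.rpow_le_rpow_of_nonpos (by positivity) (by push_cast; linarith) (by linarith)
    calc _ ≤ 2 * (A + m) * (A / (A + m)) ^ (2 * κ) :=
          mul_le_mul h1 (h.prod_le m) (Finset.prod_nonneg fun k _ => (h.stairRatio_pos k).le)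
            (by positivity)
      _ = 2 * A ^ (2 * κ) * (A + m) ^ (1 - 2 * κ) := by
          rw [Real.div_rpow hA0.le (by positivity), Real.rpow_sub (by positivity), Real.rpow_one]
          ring
      _ ≤ _ := by gcongr

end IsStairStart

end

/-! ### The staircase: gradient matrices -/

/-- The index of the diagonal entry which is changed at step `k`. -/
def stairIndex (k : ℕ) : Fin 2 := if Even k then 0 else 1

theorem stairIndex_add_two (k : ℕ) : stairIndex (k + 2) = stairIndex k := by
  simp [stairIndex, Nat.even_add]

theorem stairIndex_ne_succ (k : ℕ) : stairIndex k ≠ stairIndex (k + 1) := by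
  by_cases h : Even k <;> simp [stairIndex, h, Nat.even_add_one]

/-- The off-diagonal entries are within `β` of those of `!![*, 1; -1, *]`. -/
def OffDiagNear (β : ℝ) (X : Mat) : Prop := |X 0 1 - 1| ≤ β ∧ |X 1 0 + 1| ≤ β

/-- The gradients which are still active at step `k`. -/
def stairActive (a d : ℝ) (β : ℕ → ℝ) (k : ℕ) : Set Mat :=
  {X | X (stairIndex k) (stairIndex k) = stair a d k ∧
    X (stairIndex (k + 1)) (stairIndex (k + 1)) = stair a d (k + 1) ∧ OffDiagNear (β k) X}

/-- The final gradients which are split off at step `k`. -/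
def stairFinal (θ a d : ℝ) (β : ℕ → ℝ) (k : ℕ) : Set Mat :=
  {X | X (stairIndex k) (stairIndex k) = θ * stair a d (k + 1) ∧
    X (stairIndex (k + 1)) (stairIndex (k + 1)) = stair a d (k + 1) ∧ OffDiagNear (β (k + 1)) X}

theorem offDiagNear_add {i j : Fin 2} (hij : i ≠ j) {X : Mat} {β β' r τ : ℝ}
    (hX : OffDiagNear β X) (hτ : τ = β' - β ∨ τ = -(β' - β)) (hβ : β ≤ β') :
    OffDiagNear β' (X + Matrix.single i i r + Matrix.single i j τ) := by
  have hτ' : |τ| ≤ β' - β := by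
    rcases hτ with rfl | rfl
    · rw [abs_of_nonneg (by linarith)]
    · rw [abs_neg, abs_of_nonneg (by linarith)]
  obtain ⟨h1, h2⟩ := hX
  rw [abs_le] at h1 h2 hτ'
  unfold OffDiagNear
  rw [abs_le, abs_le]
  fin_cases i <;> fin_cases j <;> simp at hij ⊢ <;>
    refine ⟨⟨?_, ?_⟩, ?_, ?_⟩ <;> linarith

theorem canSplit_stair {κ a d : ℝ} (h : IsStairStart κ a d) {β : ℕ → ℝ} (hβ : ∀ k, β k < β (k + 1))
    (k : ℕ) :
    CanSplit (stairActive a d β k) (stairFinal (1 - 1 / κ) a d β k) (stairActive a d β (k + 1))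
      (stairRatio (1 - 1 / κ) a d k)
      (stair a d (k + 2) - stair a d k + (stair a d k - (1 - 1 / κ) * stair a d (k + 1)) +
        (β (k + 1) - β k)) := by
  have hij := stairIndex_ne_succ k
  refine canSplit_of_forall hij (_root_.sub_pos.2 (stair_lt_add_two k)) (h.sub_pos k)
    (_root_.sub_pos.2 (hβ k)) ?_ ?_
  · rintro X ⟨h1, h2, h3⟩ τ hτ
    refine ⟨?_, ?_, offDiagNear_add hij h3 hτ (hβ k).le⟩
    · simp [hij, h2]
    · rw [stairIndex_add_two]
      simp [hij.symm, h1]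
  · rintro X ⟨h1, h2, h3⟩ τ hτ
    refine ⟨?_, ?_, offDiagNear_add hij h3 hτ (hβ k).le⟩
    · simp [hij.symm, h1]
    · simp [hij, h2]

theorem mem_setKΓ {Λ lam : ℝ} (hΛ : 1 < Λ) (hlam : lam = Λ ∨ lam = Λ⁻¹) {X : Mat}
    (h0 : 0 < X 0 0) (h1 : X 1 1 = lam * X 0 0) (h2 : 0 < X 0 1) (h3 : -X 1 0 ≤ Λ * X 0 1)
    (h4 : X 0 1 ≤ Λ * -X 1 0) : X ∈ setKΓ Λ Λ := by
  have hΛ0 : 0 < Λ := by linarith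
  have hc : 0 < -X 1 0 := by
    by_contra hc
    nlinarith
  have hinv : Λ⁻¹ < 1 := inv_lt_one_of_one_lt₀ hΛ
  have hinv0 : 0 < Λ⁻¹ := by positivity
  have hlam0 : 0 < lam := by rcases hlam with rfl | rfl <;> assumption
  have hlam1 : lam ≤ Λ := by rcases hlam with rfl | rfl <;> linarith
  have hlam2 : 1 ≤ Λ * lam := by
    rcases hlam with rfl | rfl
    · nlinarith
    · rw [mul_inv_cancel₀ hΛ0.ne']
  -- The off-diagonal ratio is the free parameter `α`. As `lam` and `α` both lie in `[Λ⁻¹, Λ]`, so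
  -- does the quotient of the row sums, hence `Γ = Λ` suffices.
  refine ⟨⟨lam, hlam, -X 1 0 / X 0 1, ⟨?_, ?_⟩, ?_⟩, ?_⟩
  · rw [le_div_iff₀ h2, inv_mul_le_iff₀ hΛ0]
    exact h4
  · rw [div_le_iff₀ h2]
    exact h3
  · ext k
    fin_cases k
    · simp [h1]
      ring
    · simp
      field_simp
      ring
  · rw [abs_of_pos h0, abs_of_pos h2, abs_of_neg (by linarith : X 1 0 < 0), h1,
      abs_of_pos (by positivity)]
    have hp : 0 < -X 1 0 + lam * X 0 0 := by positivity
    constructor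
    · rw [le_div_iff₀ hp, inv_mul_le_iff₀ hΛ0]
      nlinarith
    · rw [div_le_iff₀ hp]
      nlinarith

/-- The diagonal ratio is exact: `Λ` at even steps, `Λ⁻¹` at odd ones. The off-diagonal entries have
absolute values in `[1 - 2γ, 1 + 2γ]`, so their ratio is admissible by the choice of `γ`. -/
theorem stairFinal_subset {Λ κ a d γ : ℝ} (hΛ : 1 < Λ) (hκ : Λ⁻¹ = 1 - 1 / κ)
    (hγ1 : 2 * γ < 1) (hγ : 1 + 2 * γ ≤ Λ * (1 - 2 * γ)) (h : IsStairStart κ a d) {β : ℕ → ℝ}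
    (hβ : ∀ k, β k ≤ 2 * γ) (k : ℕ) : stairFinal (1 - 1 / κ) a d β k ⊆ setKΓ Λ Λ := by
  rintro X ⟨h1, h2, h3, h4⟩
  have hΛ0 : 0 < Λ := by linarith
  have he : 0 < stair a d (k + 1) := by linarith [h.lt_stair (k + 1), h.one_lt]
  rw [abs_le] at h3 h4
  have hb := hβ (k + 1)
  rw [← hκ] at h1
  have h5 : -X 1 0 ≤ Λ * X 0 1 := by nlinarith
  have h6 : X 0 1 ≤ Λ * -X 1 0 := by nlinarith
  by_cases hk : Even k
  · simp only [stairIndex, hk, Nat.even_add_one, if_true, if_false, not_true] at h1 h2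
    refine mem_setKΓ hΛ (Or.inl rfl) ?_ ?_ (by linarith) h5 h6
    · rw [h1]; positivity
    · rw [h1, h2, mul_inv_cancel_left₀ hΛ0.ne']
  · simp only [stairIndex, hk, Nat.even_add_one, if_true, if_false, not_false_eq_true] at h1 h2
    refine mem_setKΓ hΛ (Or.inr rfl) ?_ ?_ (by linarith) h5 h6
    · rw [h2]; exact he
    · rw [h1, h2]

theorem abs_le_matNorm (X : Mat) (i j : Fin 2) : |X i j| ≤ matNorm X := by
  unfold matNorm
  apply Real.abs_le_sqrt
  simp only [Fin.sum_univ_two]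
  fin_cases i <;> fin_cases j <;> simp <;>
    linarith [sq_nonneg (X 0 0), sq_nonneg (X 0 1), sq_nonneg (X 1 0), sq_nonneg (X 1 1)]

/-- Norm of a final gradient. -/
theorem matNorm_stairFinal {κ a d : ℝ} (h : IsStairStart κ a d) {β : ℕ → ℝ} (hβ : ∀ k, β k ≤ 1)
    {k : ℕ} {X : Mat} (hX : X ∈ stairFinal (1 - 1 / κ) a d β k) :
    stair a d (k + 1) ≤ matNorm X ∧ matNorm X ≤ 2 * stair a d (k + 1) := by
  obtain ⟨h1, h2, h3, h4⟩ := hX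
  have hκ := h.one_lt
  have hθ0 : 0 ≤ 1 - 1 / κ := by
    rw [sub_nonneg, div_le_one (by linarith)]; exact hκ.le
  have hθ1 : 1 - 1 / κ ≤ 1 := by
    have : 0 < 1 / κ := by positivity
    linarith
  have he : 4 < stair a d (k + 1) := by linarith [h.lt_stair (k + 1)]
  set e := stair a d (k + 1)
  have hb := hβ (k + 1)
  rw [abs_le] at h3 h4
  refine ⟨?_, ?_⟩
  · rw [← h2]
    exact (le_abs_self _).trans (abs_le_matNorm X _ _)
  · unfold matNorm
    apply Real.sqrt_le_iff.2 ⟨by linarith, ?_⟩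
    have hs : X 0 0 ^ 2 + X 1 1 ^ 2 ≤ 2 * e ^ 2 := by
      have e1 : X 0 0 ^ 2 + X 1 1 ^ 2 = X (stairIndex k) (stairIndex k) ^ 2 +
          X (stairIndex (k + 1)) (stairIndex (k + 1)) ^ 2 := by
        by_cases hk : Even k
        · simp [stairIndex, hk, Nat.even_add_one]
        · simp [stairIndex, hk, Nat.even_add_one, add_comm]
      rw [e1, h1, h2]
      have : ((1 - 1 / κ) * e) ^ 2 ≤ e ^ 2 := by
        apply pow_le_pow_left₀ (mul_nonneg hθ0 (by linarith))
        exact mul_le_of_le_one_left (by linarith) hθ1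
      linarith
    simp only [Fin.sum_univ_two]
    nlinarith

theorem abs_entry_le {κ a d : ℝ} (h : IsStairStart κ a d) {β : ℕ → ℝ} (hβ : ∀ k, β k ≤ 1) (k : ℕ)
    {X : Mat} (hX : X ∈ stairActive a d β k ∪ stairFinal (1 - 1 / κ) a d β k) (i j : Fin 2) :
    |X i j| ≤ stair a d (k + 2) := by
  have hκ := h.one_lt
  have hθ0 : 0 ≤ 1 - 1 / κ := by
    rw [sub_nonneg, div_le_one (by linarith)]; exact hκ.le
  have hθ1 : 1 - 1 / κ ≤ 1 := by
    have : 0 < 1 / κ := by positivity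
    linarith
  have e0 := h.lt_stair k
  have e1 := h.lt_stair (k + 1)
  have m1 := stair_lt_add_two (a := a) (d := d) k
  have m2 : stair a d (k + 1) ≤ stair a d (k + 2) := stair_succ_mono k.le_succ
  obtain ⟨p1, p2, p3⟩ : |X (stairIndex k) (stairIndex k)| ≤ stair a d (k + 2) ∧
      |X (stairIndex (k + 1)) (stairIndex (k + 1))| ≤ stair a d (k + 2) ∧ OffDiagNear 1 X := by
    rcases hX with ⟨h1, h2, h3, h4⟩ | ⟨h1, h2, h3, h4⟩
    · rw [h1, h2, abs_of_pos (by linarith), abs_of_pos (by linarith)]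
      exact ⟨m1.le, m2, h3.trans (hβ _), h4.trans (hβ _)⟩
    · rw [h1, h2, abs_of_nonneg (mul_nonneg hθ0 (by linarith)), abs_of_pos (by linarith)]
      exact ⟨(mul_le_of_le_one_left (by linarith) hθ1).trans m2, m2, h3.trans (hβ _),
        h4.trans (hβ _)⟩
  have hd : ∀ i, |X i i| ≤ stair a d (k + 2) := by
    intro i
    by_cases hi : i = stairIndex k
    · rw [hi]; exact p1
    · have : i = stairIndex (k + 1) := by
        have := stairIndex_ne_succ k
        omega
      rw [this]; exact p2
  obtain ⟨p3, p4⟩ := p3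
  rw [abs_le] at p3 p4
  fin_cases i <;> fin_cases j
  · exact hd 0
  · exact abs_le.2 ⟨by simp; linarith, by simp; linarith⟩
  · exact abs_le.2 ⟨by simp; linarith, by simp; linarith⟩
  · exact hd 1

/-! ### Distribution function and conclusion -/

/-- An index up to which the final gradients have norm at most `t`, with an upper bound for the
proportion of the domain which remains. -/
theorem IsStairStart.exists_upper_index {κ a d t n : ℝ} (h : IsStairStart κ a d) (ht : 0 < t)
    (hn : max a d ≤ n) (hn1 : 1 ≤ n) :
    ∃ m : ℕ, (∀ k < m, 2 * stair a d (k + 1) ≤ t) ∧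
      ∏ k ∈ Finset.range m, stairRatio (1 - 1 / κ) a d k ≤
        (4 + κ) ^ (2 * κ) * (1 + n ^ (2 * κ)) * t ^ (-(2 * κ)) := by
  have hκ := h.one_lt
  have hS : 4 * κ ≤ max a d := h.lt_left.le.trans (le_max_left a d)
  have key : ∀ A : ℝ, 0 ≤ A → A ≤ (4 + κ) * n →
      (A / t) ^ (2 * κ) ≤ (4 + κ) ^ (2 * κ) * (1 + n ^ (2 * κ)) * t ^ (-(2 * κ)) := by
    intro A hA0 hA
    rw [Real.div_rpow hA0 ht.le, Real.rpow_neg ht.le, div_eq_mul_inv]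
    gcongr
    calc A ^ (2 * κ) ≤ ((4 + κ) * n) ^ (2 * κ) := by gcongr
      _ = (4 + κ) ^ (2 * κ) * n ^ (2 * κ) := Real.mul_rpow (by positivity) (by positivity)
      _ ≤ _ := by gcongr; linarith
  set A := 2 * max a d + 2 + κ with hA
  have hAn : A ≤ (4 + κ) * n := by
    have : κ ≤ κ * n := le_mul_of_one_le_right (by linarith) hn1
    linarith
  rcases lt_or_ge t (2 * max a d + 2) with hlt | hge
  -- For small `t` the whole domain is allowed: the claimed bound is at least 1.
  · refine ⟨0, by simp, ?_⟩
    rw [Finset.prod_range_zero]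
    refine le_trans (Real.one_le_rpow ?_ (by linarith)) (key A (by linarith) hAn)
    rw [one_le_div ht]
    linarith
  -- The largest `m` with `2 * stair a d (m + 2) ≤ t`, up to rounding; then `A + m ≥ t` because `κ >
  -- 1`.
  · set m := ⌊t - (2 * max a d + 2)⌋₊ with hm
    have hm1 : (m : ℝ) ≤ t - (2 * max a d + 2) := Nat.floor_le (by linarith)
    have hm2 : t - (2 * max a d + 2) < m + 1 := Nat.lt_floor_add_one _
    refine ⟨m + 2, fun k hk => ?_, ?_⟩
    · have h1 : stair a d (k + 1) ≤ stair a d (m + 2) :=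
        stair_succ_mono (a := a) (d := d) (by omega : k ≤ m + 1)
      have h2 : stair a d (m + 2) = max a d + 1 + m / 2 := rfl
      linarith
    · refine (h.prod_le m).trans (le_trans ?_ (key A (by linarith) hAn))
      have hmn : (0 : ℝ) ≤ m := m.cast_nonneg
      rw [← hA]
      have hle : A / (A + m) ≤ A / t := by
        apply div_le_div_of_nonneg_left <;> linarith
      exact Real.rpow_le_rpow (div_nonneg (by linarith) (by linarith)) hle (by linarith)

/-- An index from which on the final gradients exceed `t`, with a lower bound for the proportion of
the domain which remains. -/
theorem IsStairStart.exists_lower_index {κ a d t : ℝ} (h : IsStairStart κ a d) (ht : 1 < t) :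
    ∃ m : ℕ, (∀ k, m ≤ k → t < stair a d (k + 1)) ∧
      1 / (4 * κ) * (1 / (4 * κ)) * (1 / 4) ^ (2 * κ) * t ^ (-(2 * κ)) ≤
        ∏ k ∈ Finset.range m, stairRatio (1 - 1 / κ) a d k := by
  have hκ := h.one_lt
  have hS : 4 * κ ≤ max a d := h.lt_left.le.trans (le_max_left a d)
  -- Entries grow by `1/2` per step, so `2t` steps bring them above `t` from any start.
  set m := ⌈2 * t⌉₊ with hm
  have hm1 : 2 * t ≤ m := Nat.le_ceil _
  have hm2 : (m : ℝ) < 2 * t + 1 := Nat.ceil_lt_add_one (by linarith)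
  refine ⟨m + 2, fun k hk => ?_, ?_⟩
  · have h1 : stair a d (m + 2) ≤ stair a d (k + 1) :=
      stair_succ_mono (a := a) (d := d) (by omega : m + 1 ≤ k)
    have h2 : stair a d (m + 2) = max a d + 1 + m / 2 := rfl
    linarith
  · refine le_trans ?_ (h.le_prod m)
    rw [mul_assoc]
    have ht0 : 0 < t := by linarith
    set B := 2 * max a d + 3 - κ with hB
    have hB1 : 1 ≤ B := by linarith
    have e : (1 / 4 : ℝ) ^ (2 * κ) * t ^ (-(2 * κ)) = (1 / (4 * t)) ^ (2 * κ) := by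
      rw [Real.rpow_neg ht0.le, ← Real.inv_rpow ht0.le, ← Real.mul_rpow (by norm_num)
        (by positivity)]
      congr 1
      field_simp
    rw [e]
    have hle : 1 / (4 * t) ≤ B / (B + m) := by
      rw [div_le_div_iff₀ (by positivity) (by positivity)]
      nlinarith
    exact mul_le_mul_of_nonneg_left (Real.rpow_le_rpow (by positivity) hle (by linarith))
      (by positivity)

theorem isStairStart_of_ratio {κ a d : ℝ} (hκ : 1 < κ) (ha : 4 * κ < a) (hd : 4 * κ < d)
    (h : |1 - a / d| < 1 / (4 * κ)) : IsStairStart κ a d := by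
  have hd0 : 0 < d := by linarith
  rw [abs_lt] at h
  have e1 : a = a / d * d := by field_simp
  have e2 : d / (4 * κ) = 1 / (4 * κ) * d := by ring
  refine ⟨hκ, ha, hd, ?_, ?_⟩
  · rw [e2]; nlinarith
  · rw [e2]; nlinarith

/-- The exact staircase construction. -/
theorem isExactlyReducible_stair {Λ κ γ : ℝ} (hΛ : 1 < Λ) (hκ1 : 1 < κ) (hκ : Λ⁻¹ = 1 - 1 / κ)
    (hγ0 : 0 < γ) (hγ1 : 2 * γ < 1) (hγ : 1 + 2 * γ ≤ Λ * (1 - 2 * γ)) :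
    IsExactlyReducible (setU (4 * κ) (1 / (4 * κ)) γ) (setKΓ Λ Λ) (2 * κ) := by
  have hp : (0 : ℝ) < 2 * κ := by linarith
  set c : ℝ := 1 / (4 * κ) * (1 / (4 * κ)) * (1 / 4) ^ (2 * κ) with hc
  have hc0 : 0 < c := by positivity
  -- `m₀` is the `p`-th root of the constant in `exists_lower_index`.
  refine ⟨4 + κ, by linarith, c ^ (2 * κ)⁻¹, by positivity, ?_⟩
  rintro X₀ ⟨a, b', c', d, rfl, ha, hd, had, hb', hc'⟩ b ε α q Ω hε - hα hα1 - hΩ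
  have h := isStairStart_of_ratio hκ1 ha hd had
  -- The off-diagonal tolerance starts at `γ`, that of the initial matrix, and increases strictly
  -- towards `2γ`; the increments are the side slopes `σ > 0` of the pyramids.
  let β : ℕ → ℝ := fun k => γ * (2 - (1 / 2) ^ k)
  have hβlt : ∀ k, β k < β (k + 1) := fun k => by
    have : (0 : ℝ) < (1 / 2) ^ k := by positivity
    simp only [β, pow_succ]
    nlinarith
  have hβ2 : ∀ k, β k ≤ 2 * γ := fun k => by
    have : (0 : ℝ) < (1 / 2) ^ k := by positivity
    simp only [β]
    nlinarith
  have hβ1 : ∀ k, β k ≤ 1 := fun k => (hβ2 k).trans hγ1.le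
  have hX₀ : !![a, b'; -c', d] ∈ stairActive a d β 0 := by
    refine ⟨by simp [stairIndex, stair], by simp [stairIndex, stair], ?_, ?_⟩
    · simp only [β, abs_sub_comm b' 1, Matrix.of_apply, Matrix.cons_val', Matrix.cons_val_zero,
        Matrix.cons_val_one, pow_zero]
      linarith
    · have e : -c' + 1 = 1 - c' := by ring
      simp only [β, e, Matrix.of_apply, Matrix.cons_val', Matrix.cons_val_zero,
        Matrix.cons_val_one, pow_zero]
      linarith
  obtain ⟨W, G, V, hG, hPA, hHol, hbd, hanti, hV0, hvol, hae⟩ :=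
    exists_limit_map (S := stairActive a d β) (T := stairFinal (1 - 1 / κ) a d β)
      (N := fun k => stair a d (k + 2)) (canSplit_stair h hβlt)
      (fun k => by linarith [h.sub_pos k, hβlt k, stair_lt_add_two (a := a) (d := d) k])
      (fun k => by linarith [h.lt_stair (k + 2)])
      (fun k X hX i j => abs_entry_le h hβ1 k hX i j) (fun k => (h.stairRatio_pos k).le)
      h.summable_mul_prod hΩ hX₀ b hα hα1
  have hK : ∀ᵐ x, x ∈ Ω → G x ∈ setKΓ Λ Λ := by
    filter_upwards [hae] with x hx hxΩ
    obtain ⟨k, -, -, hk⟩ := hx hxΩ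
    exact stairFinal_subset hΛ hκ hγ1 hγ h hβ2 k hk
  have hN0 : max a d ≤ matNorm !![a, b'; -c', d] := by
    refine max_le ?_ ?_
    · exact (le_abs_self a).trans (abs_le_matNorm !![a, b'; -c', d] 0 0)
    · exact (le_abs_self d).trans (abs_le_matNorm !![a, b'; -c', d] 1 1)
  have hN1 : 1 ≤ matNorm !![a, b'; -c', d] := by linarith [le_max_left a d]
  refine ⟨W, G, hG, hPA, hHol, hbd, ?_, ?_, ?_, ?_⟩
  · intro t ht
    obtain ⟨m, hm1, hm2⟩ := h.exists_upper_index ht hN0 hN1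
    calc volume {x ∈ Ω | t < matNorm (G x)} ≤ volume (V m) := by
          refine measure_mono_ae ?_
          filter_upwards [hae] with x hx hxs
          obtain ⟨k, hk, -, hkG⟩ := hx hxs.1
          have h1 := (matNorm_stairFinal h hβ1 hkG).2
          have h2 : t < matNorm (G x) := hxs.2
          have h3 : m ≤ k := by
            by_contra hlt
            linarith [hm1 k (not_le.1 hlt)]
          exact hanti h3 hk
      _ ≤ _ := by
          -- A gradient of norm above `t` is split off at some step `k ≥ m`, so its points lie in `V
          -- m`, whose volume is known exactly.
          rw [hvol]
          gcongr
  · filter_upwards [hK] with x hx hxΩ hn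
    exact absurd (hx hxΩ) hn
  · have h0 : volume {x ∈ Ω | G x ∉ setKΓ Λ Λ} = 0 := by
      rw [measure_eq_zero_iff_ae_notMem]
      filter_upwards [hK] with x hx hxs
      exact hxs.2 (hx hxs.1)
    rw [setLIntegral_measure_zero _ _ h0]
    exact ENNReal.mul_pos (ENNReal.ofReal_pos.2 hε).ne'
      (hΩ.isOpen.measure_pos volume hΩ.isConnected.nonempty).ne'
  · intro t ht
    obtain ⟨m, hm1, hm2⟩ := h.exists_lower_index ht
    rw [← Real.rpow_mul hc0.le, inv_mul_cancel₀ hp.ne', Real.rpow_one]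
    calc _ ≤ volume (V m) := by
          rw [hvol]
          gcongr
      _ ≤ volume {x ∈ Ω | t < matNorm (G x)} := by
          refine measure_mono_ae ?_
          filter_upwards [hae] with x hx hxm
          have hxΩ : x ∈ Ω := hV0 ▸ hanti (Nat.zero_le m) hxm
          obtain ⟨k, -, hk, hkG⟩ := hx hxΩ
          have h3 : m ≤ k := by
            by_contra hlt
            exact hk (hanti (not_le.1 hlt : k + 1 ≤ m) hxm)
          exact ⟨hxΩ, (hm1 k h3).trans_le (matNorm_stairFinal h hβ1 hkG).1⟩

end LaminateReduction

end

theorem theorem4p1 (Λ : ℝ) (hΛ : 1 < Λ) :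
    ∃ δ γ abar Γ : ℝ, 0 < δ ∧ 0 < γ ∧ 0 < abar ∧ 1 < Γ ∧
      LaminateReduction.IsExactlyReducible
        (LaminateReduction.setU abar δ γ) (LaminateReduction.setKΓ Λ Γ)
        (2 * Λ / (Λ - 1)) := by
  have h0 : 0 < Λ - 1 := by linarith
  have hκ : 1 < Λ / (Λ - 1) := by rw [one_lt_div h0]; linarith
  have hκ0 : 0 < Λ / (Λ - 1) := by linarith
  -- This `γ` solves `1 + 2γ = Λ (1 - 2γ)`, the limiting case in which the extreme off-diagonal
  -- ratio equals `Λ`.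
  refine ⟨1 / (4 * (Λ / (Λ - 1))), (Λ - 1) / (2 * (Λ + 1)), 4 * (Λ / (Λ - 1)), Λ, by positivity,
    by positivity, by positivity, hΛ, ?_⟩
  rw [mul_div_assoc]
  have e : 2 * ((Λ - 1) / (2 * (Λ + 1))) = (Λ - 1) / (Λ + 1) := by
    have : Λ + 1 ≠ 0 := by positivity
    field_simp
  refine LaminateReduction.isExactlyReducible_stair hΛ hκ ?_ (by positivity) ?_ ?_
  · have : Λ ≠ 0 := by positivity
    rw [one_div_div]
    field_simp
    ring
  · rw [e, div_lt_one (by positivity)]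
    linarith
  · rw [e]
    have : Λ + 1 ≠ 0 := by positivity
    apply le_of_eq
    field_simp
    ring
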